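/- **Dual Cauchy identity.** Let $q\in\mathbb C$ and let $\Xi=(\xi_0,\xi_1,\dots)$, ${\sf S}=(s_0,s_1,\dots)$ be sequences of complex numbers. Write $(x;q)_k=\prod_{r=1}^{k}(1-xq^{r-1})$. Partitions are sequences $\lambda_1\ge\lambda_2\ge\dots\ge0$ with finitely many nonzero parts, $l(\lambda)$ is the number of nonzero parts and $\lambda'$ is the conjugate partition. Put $${\sf c}_{\sf S}(\lambda)=\prod_{i\ge1}\frac{(s_i^2;q)_{\lambda_i-\lambda_{i+1}}}{(q;q)_{\lambda_i-\lambda_{i+1}}},\qquad (-{\sf S})^\lambda=\prod_{i\ge1}(-s_{i-1})^{\lambda_i}.$$ *Vertex weights.* A vertex has a bottom label $i$, a left label $j$, a top label $k$ and a right label $l$, all nonnegative integers. Set $$W_{t,s}(i,j;k,l)=\mathbf 1_{i+j=k+l}\,\mathbf 1_{i\ge l}\;s^{2l}t^{-2l}\,\frac{(s^2/t^2;q)_{i-l}\,(t^2;q)_l}{(s^2;q)_i}\,\frac{(q;q)_i}{(q;q)_{i-l}(q;q)_l},$$ $$w_{u;s}(g,0;g,0)=\tfrac{1-suq^g}{1-su},\quad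 w_{u;s}(g,0;g-1,1)=\tfrac{(q^g-1)su}{1-su},\quad w_{u;s}(g,1;g+1,0)=\tfrac{1-s^2q^g}{1-su},\quad w_{u;s}(g,1;g,1)=\tfrac{s^2q^g-su}{1-su},$$ and $w_{u;s}=0$ for all other labels. The partition function of a grid of vertices is the sum, over all labellings of the internal edges by nonnegative integers, of the product of the weights of all vertices. *Spin $q$-Whittaker functions.* For $a\in\mathbb Z_{\ge0}^n$ let $ZW^{(a)}_\lambda$ be the partition function of a grid with $n$ rows (numbered from top to bottom) and $L>l(\lambda)$ columns (numbered from left to right), where the vertex in row $i$ and column $j$ has weight $W_{t,s}$ with $t=\sqrt{\xi_{i+j}s_{i+j}/\kappa_i}$ and $s=\sqrt{s_{i+j}\xi_{i+j}s_j/\xi_j}$ (only $t^2,s^2$ matter), the left edge of row $i$ has label $a_i$, all right and bottom edges have label $0$, and the top edge of column $j$ has label $\lambda_j-\lambda_{j+1}$; it does not depend on $L$. Define $$\mathbb F_\lambda(\kappa_1,\dots,\kappa_n\mid\Xi,{\sf S})=\frac{1}{(-{\sf S})^\lambda\,{\sf c}_{\sf S}(\lambda)}\sum_{a_1+\dots+a_n=\lambda_1}\Big(\prod_{i=1}^n(\kappa_is_0/\xi_0)^{a_i}\frac{(\kappa_i^{-1}s_i\xi_i;q)_{a_i}}{(q;q)_{a_i}}\Big)ZW_\lambda^{(a)}.$$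 *Dual stable spin Hall–Littlewood functions.* For $a\in\{0,1\}^m$ let $Zw^{(a)}_\lambda$ be the partition function of a grid with $m$ rows and $L>l(\lambda)$ columns, with the same boundary conditions, where the vertex in row $i$ and column $j$ has weight $w_{u_i\xi_j;\,s_j}$. Define $$\widetilde{\sf F}_{\lambda'}(u_1,\dots,u_m\mid\Xi,{\sf S})=\frac{1}{(-{\sf S})^\lambda\,{\sf c}_{\sf S}(\lambda)}\sum_{a\in\{0,1\}^m}\Big(\prod_{i=1}^m(-u_i\xi_0s_0)^{a_i}\Big)Zw_\lambda^{(a)},\qquad \widetilde{\sf F}^*_{\lambda'}={\sf c}_{\sf S}(\lambda)\,\widetilde{\sf F}_{\lambda'}.$$ *Claim.* Let $n,m\ge0$ and let $\kappa_1,\dots,\kappa_n,u_1,\dots,u_m\in\mathbb C$. Assume that the parameters are generic in the sense that none of the denominators above vanishes: $q^r\ne1$ for all $r\ge1$; all $\xi_i$, $s_i$ $(i\ge0)$ and all $\kappa_i$ are nonzero; and for all $j\ge1$ and $r\ge0$ one has $s_j^2q^r\ne1$, $\frac{s_{i+j}\xi_{i+j}s_j}{\xi_j}q^r\ne1$ for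 $1\le i\le n$, and $u_i\xi_js_j\ne1$ for $1\le i\le m$. Then only finitely many terms of the following sum over all partitions $\lambda$ are nonzero, and $$\sum_\lambda\widetilde{\sf F}^*_{\lambda'}(u_1,\dots,u_m\mid\Xi,{\sf S})\,\mathbb F_\lambda(\kappa_1,\dots,\kappa_n\mid\Xi,{\sf S})=\prod_{i=1}^n\prod_{j=1}^m\frac{1-u_j\kappa_i}{1-u_j\xi_is_i}.$$ -/

import Mathlib

noncomputable section

namespace SpinQWhittaker

/-- The `q`-Pochhammer symbol `(x;q)_n = ∏_{i=1}^n (1 - x q^(i-1))`. -/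
def qPoch (q x : ℂ) (n : ℕ) : ℂ := ∏ r ∈ Finset.range n, (1 - x * q ^ r)

/-- The higher spin six vertex weight `w^s_{u;s}(i,j;k,l)`: `i` bottom, `j` left, `k` top,
`l` right. Unlisted weights are `0`. -/
def wWeight (q u s : ℂ) (i j k l : ℕ) : ℂ :=
  if j = 0 ∧ l = 0 ∧ k = i then (1 - s * u * q ^ i) / (1 - s * u)
  else if j = 0 ∧ l = 1 ∧ k + 1 = i then (q ^ i - 1) * s * u / (1 - s * u)
  else if j = 1 ∧ l = 0 ∧ k = i + 1 then (1 - s ^ 2 * q ^ i) / (1 - s * u)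
  else if j = 1 ∧ l = 1 ∧ k = i then (s ^ 2 * q ^ i - s * u) / (1 - s * u)
  else 0

/-- The `q`-Hahn vertex weight `W^s_{t,s}(i,j;k,l)`: `i` bottom, `j` left, `k` top, `l` right. -/
def WWeight (q t s : ℂ) (i j k l : ℕ) : ℂ :=
  if i + j = k + l ∧ l ≤ i then
    s ^ (2 * l) / t ^ (2 * l) *
      (qPoch q (s ^ 2 / t ^ 2) (i - l) * qPoch q (t ^ 2) l / qPoch q (s ^ 2) i) *
      (qPoch q q i / (qPoch q q (i - l) * qPoch q q l))
  else 0

/-- Labellings of the edges of a grid with `n` rows (numbered from top to bottom) and `L` columns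
(numbered from left to right) with prescribed left, bottom and top boundary labels and right
boundary labels `0`. For `c = (v, h)`, `v i j` is the label of the vertical edge of column `j`
directly above row `i` (and `v n j` is the bottom edge of column `j`), and `h i j` is the label of
the horizontal edge of row `i` directly to the left of column `j` (and `h i L` is the right edge of
row `i`). -/
def gridConfigs (n L : ℕ) (left : Fin n → ℕ) (bottom top : Fin L → ℕ) :
    Set ((Fin (n + 1) → Fin L → ℕ) × (Fin n → Fin (L + 1) → ℕ)) :=
  {c | c.1 0 = top ∧ c.1 (Fin.last n) = bottom ∧
    (∀ i, c.2 i 0 = left i) ∧ (∀ i, c.2 i (Fin.last L) = 0)}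

/-- The partition function of an `n × L` grid in which the vertex in row `i` and column `j` has the
weight `wt i j`: the sum over all edge labellings with the given boundary conditions of the product
of all vertex weights. (For weights obeying the conservation law only finitely many labellings
contribute.) -/
def gridPartition (n L : ℕ) (wt : Fin n → Fin L → ℕ → ℕ → ℕ → ℕ → ℂ)
    (left : Fin n → ℕ) (bottom top : Fin L → ℕ) : ℂ :=
  ∑ᶠ c ∈ gridConfigs n L left bottom top,
    ∏ i : Fin n, ∏ j : Fin L,
      wt i j (c.1 i.succ j) (c.2 i j.castSucc) (c.1 i.castSucc j) (c.2 i j.succ)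

/-- The length `l(λ)`: the number of nonzero parts. The parts of `λ` are
`λ_i = lam.rowLen (i - 1)`, `i ≥ 1`. -/
def len (lam : YoungDiagram) : ℕ := lam.colLen 0

/-- `m_i(λ') = λ_i - λ_{i+1}` for `i = j + 1`. -/
def colLabel (lam : YoungDiagram) (j : ℕ) : ℕ := lam.rowLen j - lam.rowLen (j + 1)

/-- A number of columns `L` with `l(λ), l(μ) < L`. -/
def numCols (lam mu : YoungDiagram) : ℕ := max (len lam) (len mu) + 1

/-- The mixed shift `τ_B^k A`, with entries `√(a_{i+k} b_{i+k} a_i / b_i)`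
(principal square root). -/
def mixedShift (k : ℕ) (B A : ℕ → ℂ) (i : ℕ) : ℂ :=
  Complex.sqrt (A (i + k) * B (i + k) * A i / B i)

/-- `c_S(λ) = ∏_{i ≥ 1} (s_i²;q)_{λ_i - λ_{i+1}} / (q;q)_{λ_i - λ_{i+1}}`. -/
def cNorm (q : ℂ) (S : ℕ → ℂ) (lam : YoungDiagram) : ℂ :=
  ∏ i ∈ Finset.range (len lam),
    qPoch q (S (i + 1) ^ 2) (colLabel lam i) / qPoch q q (colLabel lam i)

/-- `(-S)^λ = ∏_{i ≥ 1} (-s_{i-1})^{λ_i}`. -/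
def negPow (S : ℕ → ℂ) (lam : YoungDiagram) : ℂ :=
  ∏ i ∈ Finset.range (len lam), (-S i) ^ lam.rowLen i

/-- The partition function `ZW^{(a_1,…,a_n)}_{λ/μ}(κ_1,…,κ_n | Ξ, S)`. The vertex in (one-based) row
`i` and column `j` has the weight `W^s_{t,s}` with `t = √(ξ_{i+j} s_{i+j} / κ_i)` and
`s = √(s_{i+j} ξ_{i+j} s_j / ξ_j)`, the `j`-th entry of `τ_Ξ^i S`. -/
def ZW (q : ℂ) {n : ℕ} (kap : Fin n → ℂ) (Xi S : ℕ → ℂ) (lam mu : YoungDiagram)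
    (a : Fin n → ℕ) : ℂ :=
  gridPartition n (numCols lam mu)
    (fun i j => WWeight q
      (Complex.sqrt (Xi ((i + 1 : ℕ) + (j + 1)) * S ((i + 1 : ℕ) + (j + 1)) / kap i))
      (mixedShift (i + 1) Xi S (j + 1)))
    a (fun j => colLabel mu j) (fun j => colLabel lam j)

/-- `𝔽^s_{λ/μ}(κ_1,…,κ_n | Ξ, S)`: the sum over all `(a_1,…,a_n)` with `∑ a_r = λ_1 - μ_1`. -/
def spinWhittakerStoch (q : ℂ) {n : ℕ} (kap : Fin n → ℂ) (Xi S : ℕ → ℂ)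
    (lam mu : YoungDiagram) : ℂ :=
  ∑ᶠ a ∈ {a : Fin n → ℕ | (∑ r, a r) + mu.rowLen 0 = lam.rowLen 0},
    (∏ i : Fin n, (kap i * S 0 / Xi 0) ^ a i *
      (qPoch q ((kap i)⁻¹ * S (i + 1) * Xi (i + 1)) (a i) / qPoch q q (a i))) *
      ZW q kap Xi S lam mu a

/-- The inhomogeneous spin `q`-Whittaker function `𝔽_{λ/μ}(κ_1,…,κ_n | Ξ, S)`. -/
def spinWhittakerSkew (q : ℂ) {n : ℕ} (kap : Fin n → ℂ) (Xi S : ℕ → ℂ)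
    (lam mu : YoungDiagram) : ℂ :=
  negPow (mixedShift n Xi S) mu / negPow S lam *
    (cNorm q (mixedShift n Xi S) mu / cNorm q S lam) *
    spinWhittakerStoch q kap Xi S lam mu

/-- `𝔽_λ = 𝔽_{λ/∅}`. -/
def spinWhittaker (q : ℂ) {n : ℕ} (kap : Fin n → ℂ) (Xi S : ℕ → ℂ) (lam : YoungDiagram) : ℂ :=
  spinWhittakerSkew q kap Xi S lam ⊥

/-- The partition function `Zw^{(a_1,…,a_m)}_{λ/μ}(u_1,…,u_m | Ξ, S)`. The vertex in (one-based) row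
`i` and column `j` has the weight `w^s_{u_i ξ_j; s_j}`. -/
def Zw (q : ℂ) {m : ℕ} (u : Fin m → ℂ) (Xi S : ℕ → ℂ) (lam mu : YoungDiagram)
    (a : Fin m → ℕ) : ℂ :=
  gridPartition m (numCols lam mu)
    (fun i j => wWeight q (u i * Xi (j + 1)) (S (j + 1)))
    a (fun j => colLabel mu j) (fun j => colLabel lam j)

/-- The stochastic form of the stable spin Hall-Littlewood function with index `rho/sig`: for
`rho = λ'` and `sig = μ'` it is
`∑_{a ∈ {0,1}^m} ∏_i (-u_i ξ_0 s_0)^{a_i} Zw^{(a)}_{λ/μ}`. -/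
def stableHLStoch (q : ℂ) {m : ℕ} (u : Fin m → ℂ) (Xi S : ℕ → ℂ) (rho sig : YoungDiagram) : ℂ :=
  ∑ a : Fin m → Fin 2,
    (∏ i : Fin m, (-(u i) * Xi 0 * S 0) ^ (a i : ℕ)) *
      Zw q u Xi S rho.transpose sig.transpose (fun i => (a i : ℕ))

/-- The inhomogeneous stable spin Hall-Littlewood function with index `rho/sig`: for `rho = λ'` and
`sig = μ'` it is `(-S)^μ / (-S)^λ * c_S(μ) / c_S(λ)` times its stochastic form. -/
def stableHLSkew (q : ℂ) {m : ℕ} (u : Fin m → ℂ) (Xi S : ℕ → ℂ) (rho sig : YoungDiagram) : ℂ :=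
  negPow S sig.transpose / negPow S rho.transpose *
    (cNorm q S sig.transpose / cNorm q S rho.transpose) *
    stableHLStoch q u Xi S rho sig

/-- The dual function with index `rho/sig`: for `rho = λ'` and `sig = μ'` it is
`c_S(λ) / c_S(μ)` times the stable spin Hall-Littlewood function. -/
def stableHLDualSkew (q : ℂ) {m : ℕ} (u : Fin m → ℂ) (Xi S : ℕ → ℂ)
    (rho sig : YoungDiagram) : ℂ :=
  cNorm q S rho.transpose / cNorm q S sig.transpose * stableHLSkew q u Xi S rho sig

/-- The dual function with straight index `rho = rho/∅`. -/
def stableHLDual (q : ℂ) {m : ℕ} (u : Fin m → ℂ) (Xi S : ℕ → ℂ) (rho : YoungDiagram) : ℂ :=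
  stableHLDualSkew q u Xi S rho ⊥

end SpinQWhittaker

end

/-! Put A_k = ξ_k s_k and B_k = s_k / ξ_k, and encode a partition by its differences m_j = λ_j -
λ_{j+1}. A w-vertex in column j depends only on u A_j and A_j B_j; a W-vertex in row i and column j
depends only on A_{i+j} / κ_i and A_{i+j} B_j. Both functions are therefore products of one-row
operators applied to the empty partition, and passing from one W-row to the next shifts A while B
stays fixed.

The heart is `row_exchange`, a skew Cauchy identity for one row of each kind. Gluing a w-row and a
W-row along their top edges gives (1 - uκ)/(1 - uA_1) times the sum obtained by gluing along the
bottom edges, where the w-row now has the shifted sequence A. It is a Yang–Baxter argument. With the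
left labels ε and a held fixed, the two gluings are related by a cross whose coefficients depend on
uA_1 and uκ and preserve a - ε (`exchange`). The cross moves through one column at a time:
`exchange_step_zero` and `exchange_step_one` are the rational-function identities for a single
column, in which uA_2 on its right becomes uA_1 on its left. Summed against the left boundary
weights, the cross acts as a scalar, and this scalar is the factor above.

Carrying one W-row past all m w-rows (`hlSum_qHahnRow`) yields m factors and returns the same
problem with one W-row fewer and A shifted; induction on n gives `dualCauchy_rows`. What remains is
translation: a grid is an iterated row (`gridPartition_succ`), extra empty columns do not matter
(`gridPartition_eq_of_le`), partitions of bounded length correspond to label functions, and the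
prefactors assemble into `fullNorm`. The sum is finite because m w-rows force λ_1 ≤ m and n W-rows
force l(λ) ≤ n. -/

noncomputable section

namespace SpinQWhittaker

/-! ### Vertex weights in rational parameters -/

/-- The higher spin six vertex weight in the parameters `x = s u` and `σ = s²`. -/
def hlWeight (q x σ : ℂ) (i j k l : ℕ) : ℂ :=
  if j = 0 ∧ l = 0 ∧ k = i then (1 - x * q ^ i) / (1 - x)
  else if j = 0 ∧ l = 1 ∧ k + 1 = i then (q ^ i - 1) * x / (1 - x)
  else if j = 1 ∧ l = 0 ∧ k = i + 1 then (1 - σ * q ^ i) / (1 - x)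
  else if j = 1 ∧ l = 1 ∧ k = i then (σ * q ^ i - x) / (1 - x)
  else 0

/-- The value of the `q`-Hahn weight with bottom label `i` and right label `l ≤ i`, in the
parameters `T = t²` and `σ = s²`. -/
def qHahnCoeff (q T σ : ℂ) (i l : ℕ) : ℂ :=
  (σ / T) ^ l * (qPoch q (σ / T) (i - l) * qPoch q T l / qPoch q σ i) *
    (qPoch q q i / (qPoch q q (i - l) * qPoch q q l))

/-- The `q`-Hahn vertex weight in the parameters `T = t²` and `σ = s²`. -/
def qHahnWeight (q T σ : ℂ) (i j k l : ℕ) : ℂ :=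
  if i + j = k + l ∧ l ≤ i then qHahnCoeff q T σ i l else 0

theorem wWeight_eq (q u s : ℂ) : wWeight q u s = hlWeight q (s * u) (s ^ 2) := by
  funext i j k l
  simp only [wWeight, hlWeight, mul_assoc]

/-- Only t² and s² enter, so the choice of branch of the square roots in the definitions is
immaterial. -/
theorem WWeight_eq (q t s : ℂ) : WWeight q t s = qHahnWeight q (t ^ 2) (s ^ 2) := by
  funext i j k l
  simp only [WWeight, qHahnWeight, qHahnCoeff, pow_mul, div_pow]

theorem hlWeight_zero_zero (q x σ : ℂ) (i : ℕ) :
    hlWeight q x σ i 0 i 0 = (1 - x * q ^ i) / (1 - x) := by simp [hlWeight]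

theorem hlWeight_zero_one (q x σ : ℂ) (i : ℕ) :
    hlWeight q x σ (i + 1) 0 i 1 = (q ^ (i + 1) - 1) * x / (1 - x) := by simp [hlWeight]

theorem hlWeight_one_zero (q x σ : ℂ) (i : ℕ) :
    hlWeight q x σ i 1 (i + 1) 0 = (1 - σ * q ^ i) / (1 - x) := by simp [hlWeight]

theorem hlWeight_one_one (q x σ : ℂ) (i : ℕ) :
    hlWeight q x σ i 1 i 1 = (σ * q ^ i - x) / (1 - x) := by simp [hlWeight]

theorem hlWeight_conserve {q x σ : ℂ} {i j k l : ℕ} (h : hlWeight q x σ i j k l ≠ 0) :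
    i + j = k + l ∧ j ≤ 1 ∧ l ≤ 1 := by
  unfold hlWeight at h
  split_ifs at h <;> first | omega | exact absurd rfl h

theorem qHahnWeight_conserve {q T σ : ℂ} {i j k l : ℕ} (h : qHahnWeight q T σ i j k l ≠ 0) :
    i + j = k + l ∧ l ≤ i := by
  unfold qHahnWeight at h
  split_ifs at h with h'
  · exact h'
  · exact absurd rfl h

theorem qPoch_zero (q x : ℂ) : qPoch q x 0 = 1 := by simp [qPoch]

theorem qPoch_succ (q x : ℂ) (n : ℕ) : qPoch q x (n + 1) = qPoch q x n * (1 - x * q ^ n) := by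
  simp [qPoch, Finset.prod_range_succ]

theorem qPoch_ne_zero {q x : ℂ} (h : ∀ r : ℕ, x * q ^ r ≠ 1) (n : ℕ) : qPoch q x n ≠ 0 :=
  Finset.prod_ne_zero_iff.2 fun r _ => sub_ne_zero.2 (h r).symm

theorem qPoch_self_ne_zero {q : ℂ} (hq : ∀ r : ℕ, 1 ≤ r → q ^ r ≠ 1) (n : ℕ) :
    qPoch q q n ≠ 0 :=
  qPoch_ne_zero (fun r => by rw [← pow_succ']; exact hq _ (by omega)) n

theorem hlWeight_zero (q x σ : ℂ) (hx : x ≠ 1) : hlWeight q x σ 0 0 0 0 = 1 := by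
  rw [hlWeight_zero_zero, pow_zero, mul_one, div_self (sub_ne_zero.2 hx.symm)]

theorem qHahnWeight_zero (q T σ : ℂ) : qHahnWeight q T σ 0 0 0 0 = 1 := by
  simp [qHahnWeight, qHahnCoeff, qPoch_zero]

/-- The factor `(q;q)_m / (σ;q)_m`. -/
def labelNorm (q σ : ℂ) (m : ℕ) : ℂ := qPoch q q m / qPoch q σ m

/-! ### The local exchange relation -/

/-- One column of the left-hand side of the exchange relation: the vertex weights of a `w`-row with
bottom label `r` and a `W`-row with bottom label `i` whose top edges are glued together. -/
def leftCoeff (q σ σ' w ω : ℂ) (M r i ε a δ : ℕ) : ℂ :=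
  labelNorm q σ (r + ε - δ) * hlWeight q (w * σ) σ r ε (r + ε - δ) δ *
    qHahnWeight q (σ' / ω) σ' i a (r + ε - δ) (i + a - (r + ε - δ)) *
    (σ ^ (M + (i + a - (r + ε - δ))))⁻¹

/-- One column of the right-hand side of the exchange relation: the vertex weights of a `w`-row with
top label `i` and a `W`-row with top label `r` whose bottom edges are glued together. -/
def rightCoeff (q σ σ' w ω : ℂ) (M r i ε a δ : ℕ) : ℂ :=
  labelNorm q σ r * (labelNorm q σ' i / labelNorm q σ' (i + δ - ε)) *
    hlWeight q (w * σ') σ' (i + δ - ε) ε i δ *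
    qHahnWeight q (σ' / ω) σ' (i + δ - ε) a r (i + δ - ε + a - r) *
    (σ' ^ δ)⁻¹ * (σ ^ (M + (i + δ - ε + a - r)))⁻¹ * σ ^ δ

/-- The definition uses truncated subtraction. Once conservation is known with genuine labels m and
b, the only surviving condition of the q-Hahn weight is b ≤ i. -/
theorem leftCoeff_eq {q σ σ' w ω : ℂ} {M r i ε a δ m b : ℕ} (h : r + ε = m + δ)
    (hb : i + a = m + b) :
    leftCoeff q σ σ' w ω M r i ε a δ =
      labelNorm q σ m * hlWeight q (w * σ) σ r ε m δ *
        (if b ≤ i then qHahnCoeff q (σ' / ω) σ' i b else 0) * (σ ^ (M + b))⁻¹ := by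
  obtain rfl : m = r + ε - δ := by omega
  obtain rfl : b = i + a - (r + ε - δ) := by omega
  rw [leftCoeff, qHahnWeight, if_congr (and_iff_right hb) rfl rfl]

theorem rightCoeff_eq {q σ σ' w ω : ℂ} {M r i ε a δ n b : ℕ} (h : n + ε = i + δ)
    (hb : n + a = r + b) :
    rightCoeff q σ σ' w ω M r i ε a δ =
      labelNorm q σ r * (labelNorm q σ' i / labelNorm q σ' n) *
        hlWeight q (w * σ') σ' n ε i δ *
        (if b ≤ n then qHahnCoeff q (σ' / ω) σ' n b else 0) *
        (σ' ^ δ)⁻¹ * (σ ^ (M + b))⁻¹ * σ ^ δ := by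
  obtain rfl : n = i + δ - ε := by omega
  obtain rfl : b = i + δ - ε + a - r := by omega
  rw [rightCoeff, qHahnWeight, if_congr (and_iff_right hb) rfl rfl]

theorem leftCoeff_eq_zero {q σ σ' w ω : ℂ} {M r i ε a δ : ℕ}
    (h : r + ε - δ < a ∨ i + a < r + ε - δ) : leftCoeff q σ σ' w ω M r i ε a δ = 0 := by
  rw [leftCoeff, qHahnWeight, if_neg (by omega)]
  simp

/-- Here the subtraction truncates to a spurious label 0, but the w-weight then violates
conservation. -/
theorem leftCoeff_eq_zero_of_lt {q σ σ' w ω : ℂ} {M r i ε a δ : ℕ} (h : r + ε < δ) :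
    leftCoeff q σ σ' w ω M r i ε a δ = 0 := by
  have : hlWeight q (w * σ) σ r ε (r + ε - δ) δ = 0 := by
    by_contra h'
    have := hlWeight_conserve h'
    omega
  simp [leftCoeff, this]

theorem rightCoeff_eq_zero {q σ σ' w ω : ℂ} {M r i ε a δ : ℕ}
    (h : r < a ∨ i + δ - ε + a < r) : rightCoeff q σ σ' w ω M r i ε a δ = 0 := by
  rw [rightCoeff, qHahnWeight, if_neg (by omega)]
  simp

theorem rightCoeff_eq_zero_of_lt {q σ σ' w ω : ℂ} {M r i ε a δ : ℕ} (h : i + δ < ε) :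
    rightCoeff q σ σ' w ω M r i ε a δ = 0 := by
  have : hlWeight q (w * σ') σ' (i + δ - ε) ε i δ = 0 := by
    by_contra h'
    have := hlWeight_conserve h'
    omega
  simp [rightCoeff, this]

/-- Neighbouring `q`-Hahn coefficients as multiples of a common factor. -/
theorem qHahnCoeff_neighbours {q T σ : ℂ} (hq : ∀ r : ℕ, 1 ≤ r → q ^ r ≠ 1)
    (hσ : ∀ r : ℕ, σ * q ^ r ≠ 1) (l p : ℕ) : ∃ C : ℂ,
    qHahnCoeff q T σ (l + 1 + p) l = C * ((1 - σ / T * q ^ p) * (1 - q ^ (l + 1)) *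
      (1 - q ^ (l + p + 1)) * (1 - σ * q ^ (l + p + 1))) ∧
    qHahnCoeff q T σ (l + 1 + p) (l + 1) = C * (σ / T * (1 - T * q ^ l) * (1 - q ^ (p + 1)) *
      (1 - q ^ (l + p + 1)) * (1 - σ * q ^ (l + p + 1))) ∧
    qHahnCoeff q T σ (l + p) l = C * ((1 - q ^ (p + 1)) * (1 - q ^ (l + 1)) *
      (1 - σ * q ^ (l + p)) * (1 - σ * q ^ (l + p + 1))) ∧
    qHahnCoeff q T σ (l + 1 + p + 1) (l + 1) = C * (σ / T * (1 - σ / T * q ^ p) * (1 - T * q ^ l) *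
      (1 - q ^ (l + p + 1)) * (1 - q ^ (l + p + 2))) := by
  have f2 : ∀ k, 1 - σ * q ^ k ≠ 0 := fun k => sub_ne_zero.2 (hσ k).symm
  have f3 : ∀ k, 1 - q ^ (k + 1) ≠ 0 := fun k => sub_ne_zero.2 (hq _ (by omega)).symm
  have g2 := qPoch_ne_zero hσ (l + p)
  have g3 := qPoch_self_ne_zero hq
  have ga := g3 l
  have gb := g3 p
  have gc := g3 (l + p)
  have fa := f3 l
  have fb := f3 p
  have fc := f2 (l + p)
  have fd := f2 (l + p + 1)
  -- The common factor takes the shortest Pochhammer symbols occurring in the four numerators and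
  -- the longest in their denominators, so all four cofactors are polynomial in σ / T, T, σ and
  -- powers of q.
  refine ⟨(σ / T) ^ l * (qPoch q (σ / T) p * qPoch q T l / qPoch q σ (l + p)) *
    (qPoch q q (l + p) / (qPoch q q (p + 1) * qPoch q q (l + 1))) /
    ((1 - σ * q ^ (l + p)) * (1 - σ * q ^ (l + p + 1))), ?_, ?_, ?_, ?_⟩
  · rw [qHahnCoeff, show l + 1 + p - l = p + 1 by omega, show l + 1 + p = l + p + 1 by omega]
    simp only [qPoch_succ, ← pow_succ']
    generalize σ / T = ω
    field_simp
  · rw [qHahnCoeff, show l + 1 + p - (l + 1) = p by omega, show l + 1 + p = l + p + 1 by omega]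
    simp only [qPoch_succ, ← pow_succ']
    generalize σ / T = ω
    field_simp
    ring
  · rw [qHahnCoeff, show l + p - l = p by omega]
    simp only [qPoch_succ, ← pow_succ']
    generalize σ / T = ω
    field_simp
  · rw [qHahnCoeff, show l + 1 + p + 1 - (l + 1) = p + 1 by omega,
      show l + 1 + p + 1 = l + p + 1 + 1 by omega]
    simp only [qPoch_succ, ← pow_succ']
    generalize σ / T = ω
    field_simp
    ring

/-- Diagonal `q`-Hahn coefficients. -/
theorem qHahnCoeff_diag_succ {q T σ : ℂ} (hq : ∀ r : ℕ, 1 ≤ r → q ^ r ≠ 1)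
    (hσ : ∀ r : ℕ, σ * q ^ r ≠ 1) (l : ℕ) :
    qHahnCoeff q T σ (l + 1) (l + 1) * (1 - σ * q ^ l) =
      qHahnCoeff q T σ l l * (σ / T * (1 - T * q ^ l)) := by
  have f2 : 1 - σ * q ^ l ≠ 0 := sub_ne_zero.2 (hσ l).symm
  have f3 : 1 - q ^ (l + 1) ≠ 0 := sub_ne_zero.2 (hq _ (by omega)).symm
  have g2 := qPoch_ne_zero hσ l
  have g3 := qPoch_self_ne_zero hq l
  simp only [qHahnCoeff, Nat.sub_self, qPoch_succ, ← pow_succ', qPoch_zero, pow_succ (σ / T)]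
  generalize σ / T = ω
  generalize q ^ l = y at *
  have f2' : 1 - y * σ ≠ 0 := by rwa [mul_comm]
  field_simp

theorem qHahnCoeff_zero_right {q T σ : ℂ} (hq : ∀ r : ℕ, 1 ≤ r → q ^ r ≠ 1) (i : ℕ) :
    qHahnCoeff q T σ i 0 = qPoch q (σ / T) i / qPoch q σ i := by
  have g3 := qPoch_self_ne_zero hq i
  simp [qHahnCoeff, qPoch_zero, g3]

theorem labelNorm_succ (q σ : ℂ) (m : ℕ) :
    labelNorm q σ (m + 1) = labelNorm q σ m * ((1 - q ^ (m + 1)) / (1 - σ * q ^ m)) := by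
  rw [labelNorm, labelNorm, qPoch_succ, qPoch_succ, pow_succ', mul_div_mul_comm]

theorem labelNorm_ne_zero {q σ : ℂ} (hq : ∀ r : ℕ, 1 ≤ r → q ^ r ≠ 1)
    (hσ : ∀ r : ℕ, σ * q ^ r ≠ 1) (m : ℕ) : labelNorm q σ m ≠ 0 :=
  div_ne_zero (qPoch_self_ne_zero hq m) (qPoch_ne_zero hσ m)

/-! ### Moving the cross through one column -/

section local_relation

variable {q σ σ' w ω : ℂ} (hq : ∀ r : ℕ, 1 ≤ r → q ^ r ≠ 1) (hσ₀ : σ ≠ 0) (hσ₀' : σ' ≠ 0)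
  (hω : ω ≠ 0) (hσ : ∀ r : ℕ, σ * q ^ r ≠ 1)
  (hσ' : ∀ r : ℕ, σ' * q ^ r ≠ 1) (hw : w * σ ≠ 1) (hw' : w * σ' ≠ 1)
  {l₀ l₁ r₀ r₁ : ℕ → ℂ}
  (h₀ : ∀ D, (1 - w * σ') * l₀ D =
    (1 - w * σ' * q ^ D) * r₀ D - w * (ω - σ' * q ^ D) * r₁ (D + 1))
  (h₁ : ∀ a, (1 - w * σ') * l₁ a = (1 - q ^ a) * r₀ (a - 1) + (q ^ a - w * ω) * r₁ a)
include hq hσ₀ hσ₀' hω hσ hσ' hw hw' h₀ h₁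

/-- The functions l and r stand for the two gluings of all columns further to the right, as
functions of the horizontal W-label; the subscript is the horizontal w-label. The hypotheses are the
exchange relation there, at wσ'; the conclusion is its ε = 0 half after one more column is put on
the left, at wσ. Eliminating l₀ and l₁ leaves a comparison of the coefficients of two values of r₀
and r₁. -/
theorem exchange_step_zero (M r i D : ℕ) :
    (1 - w * σ) * (leftCoeff q σ σ' w ω M r i 0 D 0 * l₀ (i + D - r) +
        leftCoeff q σ σ' w ω M r i 0 D 1 * l₁ (i + D - (r - 1))) =
      (1 - w * σ * q ^ D) * (rightCoeff q σ σ' w ω M r i 0 D 0 * r₀ (i + D - r) +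
        rightCoeff q σ σ' w ω M r i 0 D 1 * r₁ (i + 1 + D - r)) -
      w * (ω - σ * q ^ D) * (rightCoeff q σ σ' w ω M r i 1 (D + 1) 0 * r₀ (i - 1 + (D + 1) - r) +
        rightCoeff q σ σ' w ω M r i 1 (D + 1) 1 * r₁ (i + (D + 1) - r)) := by
  have e1 : 1 - w * σ ≠ 0 := sub_ne_zero.2 hw.symm
  have e2 : 1 - w * σ' ≠ 0 := sub_ne_zero.2 hw'.symm
  have eT : σ' / (σ' / ω) = ω := by field_simp
  have f1 : ∀ k, 1 - σ * q ^ k ≠ 0 := fun k => sub_ne_zero.2 (hσ k).symm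
  have f2 : ∀ k, 1 - σ' * q ^ k ≠ 0 := fun k => sub_ne_zero.2 (hσ' k).symm
  have f3 : ∀ k, 1 - q ^ (k + 1) ≠ 0 := fun k => sub_ne_zero.2 (hq _ (by omega)).symm
  have e3 : ∀ a, l₀ a = ((1 - w * σ' * q ^ a) * r₀ a - w * (ω - σ' * q ^ a) * r₁ (a + 1)) /
      (1 - w * σ') := fun a => by rw [← h₀]; field_simp
  have e4 : ∀ a, l₁ a = ((1 - q ^ a) * r₀ (a - 1) + (q ^ a - w * ω) * r₁ a) / (1 - w * σ') :=
    fun a => by rw [← h₁]; field_simp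
  have n1 := labelNorm_ne_zero hq hσ'
  have g2 := qPoch_ne_zero hσ'
  rw [e3, e4]
  -- On the left side the W-vertex emits b = i + D - r + δ, and the weight needs 0 ≤ b ≤ i. So
  -- everything vanishes for r < D; for r = D only the diagonal b = i occurs there; for r = D + p +
  -- 1 one has b = i - p - 1 + δ, generic for p < i, only b = 0 for p = i, and impossible for p > i.
  rcases lt_trichotomy r D with h | rfl | h
  · rw [leftCoeff_eq_zero (by omega), leftCoeff_eq_zero (by omega), rightCoeff_eq_zero (by omega),
      rightCoeff_eq_zero (by omega), rightCoeff_eq_zero (by omega), rightCoeff_eq_zero (by omega)]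
    ring
  · have z : leftCoeff q σ σ' w ω M r i 0 r 1 = 0 := by
      rcases r with _ | r
      · exact leftCoeff_eq_zero_of_lt (by omega)
      · exact leftCoeff_eq_zero (by omega)
    have d := qHahnCoeff_diag_succ (T := σ' / ω) hq hσ' i
    rw [eT, ← eq_div_iff (f2 i)] at d
    rw [z, rightCoeff_eq_zero (ε := 1) (by omega), rightCoeff_eq_zero (ε := 1) (by omega),
      leftCoeff_eq (m := r) (b := i) (by omega) (by omega),
      rightCoeff_eq (n := i) (b := i) (by omega) (by omega),
      rightCoeff_eq (n := i + 1) (b := i + 1) (by omega) (by omega), if_pos le_rfl, if_pos le_rfl,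
      show i + r - r = i by omega, show i + 1 + r - r = i + 1 by omega,
      hlWeight_zero_zero, hlWeight_zero_zero, hlWeight_zero_one, d, labelNorm_succ]
    have := n1 i
    have := f2 i
    have := f3 i
    generalize labelNorm q σ r = N
    generalize hN' : labelNorm q σ' i = N' at *
    generalize qHahnCoeff q (σ' / ω) σ' i i = C
    simp only [← add_assoc, pow_succ, pow_zero] at *
    generalize σ ^ (M + i) = Z
    generalize q ^ i = y at *
    generalize q ^ r = y' at *
    field_simp
    ring
  · obtain ⟨p, rfl⟩ := Nat.exists_eq_add_of_lt h
    rcases lt_trichotomy p i with h | rfl | h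
    · obtain ⟨l, rfl⟩ := Nat.exists_eq_add_of_lt h
      obtain ⟨C, c1, c2, c3, c4⟩ := qHahnCoeff_neighbours (T := σ' / ω) hq hσ' l p
      rw [eT] at c1 c2 c4
      have hi : p + l + 1 = l + p + 1 := by omega
      have hi' : l + 1 + p = l + p + 1 := by omega
      rw [hi'] at c1 c2 c4
      rw [hi]
      rw [leftCoeff_eq (m := D + p + 1) (b := l) (by omega) (by omega),
        leftCoeff_eq (m := D + p) (b := l + 1) (by omega) (by omega),
        rightCoeff_eq (ε := 0) (n := l + p + 1) (b := l) (by omega) (by omega),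
        rightCoeff_eq (ε := 0) (n := l + p + 1 + 1) (b := l + 1) (by omega) (by omega),
        rightCoeff_eq (ε := 1) (n := l + p) (b := l) (by omega) (by omega),
        rightCoeff_eq (ε := 1) (δ := 1) (n := l + p + 1) (b := l + 1) (by omega) (by omega),
        if_pos (by omega), if_pos (by omega), if_pos (by omega), if_pos (by omega),
        c1, c2, c3, c4, show l + p + 1 + D - (D + p + 1) = l by omega,
        show l + p + 1 + D - (D + p + 1 - 1) = l + 1 by omega,
        show l + p + 1 + 1 + D - (D + p + 1) = l + 1 by omega,
        show l + p + 1 - 1 + (D + 1) - (D + p + 1) = l by omega,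
        show l + p + 1 + (D + 1) - (D + p + 1) = l + 1 by omega,
        hlWeight_zero_zero, hlWeight_zero_one, hlWeight_zero_zero, hlWeight_zero_one,
        hlWeight_one_zero, hlWeight_one_one, labelNorm_succ, labelNorm_succ, labelNorm_succ,
        labelNorm_succ, Nat.add_sub_cancel]
      have := n1 (l + p)
      have := f2 (l + p)
      have := f3 (l + p)
      have := f2 (l + p + 1)
      have := f3 (l + p + 1)
      have := f1 (D + p)
      generalize labelNorm q σ (D + p) = N
      generalize labelNorm q σ' (l + p) = N' at *
      clear c1 c2 c3 c4 e3 e4 h₀ h₁ n1 g2 f1 f2 f3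
      simp only [← add_assoc, pow_succ, pow_zero, pow_add q D p, pow_add q l p] at *
      generalize σ ^ (M + l) = Z
      generalize q ^ p = x at *
      generalize q ^ l = y at *
      generalize q ^ D = z at *
      generalize r₀ l = R₀
      generalize r₁ (l + 1) = R₁
      -- Denominators are cleared with these factors as indeterminates; their values are restored
      -- only for the final polynomial identity.
      generalize h1 : 1 - σ' * (y * x) = d1 at *
      generalize h2 : 1 - y * x * q = d2 at *
      generalize h3 : 1 - σ' * (y * x * q) = d3 at *
      generalize h4 : 1 - y * x * q * q = d4 at *
      generalize h5 : 1 - σ * (z * x) = d5 at *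
      generalize h6 : 1 - w * σ = d6 at *
      generalize h7 : 1 - w * σ' = d7 at *
      have h4' : y * x * q * q - 1 = -d4 := by rw [← h4]; ring
      rw [h4']
      field_simp
      subst h1 h2 h3 h4 h5 h6 h7
      ring
    -- The label emitted would be -1. For p = 0 the glued label would itself be negative, and it is
    -- the w-weight that vanishes.
    · have z : rightCoeff q σ σ' w ω M (D + p + 1) p 1 (D + 1) 0 = 0 := by
        rcases p with _ | p
        · exact rightCoeff_eq_zero_of_lt (by omega)
        · exact rightCoeff_eq_zero (by omega)
      rw [z, leftCoeff_eq_zero (δ := 0) (by omega), rightCoeff_eq_zero (ε := 0) (δ := 0) (by omega),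
        leftCoeff_eq (m := D + p) (b := 0) (by omega) (by omega),
        rightCoeff_eq (ε := 0) (n := p + 1) (b := 0) (by omega) (by omega),
        rightCoeff_eq (ε := 1) (δ := 1) (n := p) (b := 0) (by omega) (by omega),
        if_pos (Nat.zero_le p), if_pos (Nat.zero_le (p + 1)),
        show p + D - (D + p + 1 - 1) = 0 by omega, show p + 1 + D - (D + p + 1) = 0 by omega,
        show p + (D + 1) - (D + p + 1) = 0 by omega,
        hlWeight_zero_one, hlWeight_zero_one, hlWeight_one_one,
        qHahnCoeff_zero_right hq, qHahnCoeff_zero_right hq, eT, labelNorm_succ, labelNorm_succ,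
        qPoch_succ, qPoch_succ]
      have := n1 p
      have := f2 p
      have := f3 p
      have := f1 (D + p)
      have := g2 p
      generalize labelNorm q σ (D + p) = N
      generalize labelNorm q σ' p = N' at *
      generalize qPoch q σ' p = G at *
      generalize qPoch q ω p = C
      simp only [← add_assoc, pow_succ, pow_zero, pow_add q D p] at *
      generalize σ ^ (M + 0) = Z
      generalize q ^ p = y at *
      generalize q ^ D = y' at *
      rw [← mul_assoc σ] at *
      field_simp
      ring
    · rw [leftCoeff_eq_zero (by omega), leftCoeff_eq_zero (by omega),
        rightCoeff_eq_zero (by omega), rightCoeff_eq_zero (by omega),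
        rightCoeff_eq_zero (by omega), rightCoeff_eq_zero (by omega)]
      ring

/-- The ε = 1 half of the same column relation, with the same division into cases. -/
theorem exchange_step_one (M r i a : ℕ) :
    (1 - w * σ) * (leftCoeff q σ σ' w ω M r i 1 a 0 * l₀ (i + a - (r + 1)) +
        leftCoeff q σ σ' w ω M r i 1 a 1 * l₁ (i + a - r)) =
      (1 - q ^ a) * (rightCoeff q σ σ' w ω M r i 0 (a - 1) 0 * r₀ (i + (a - 1) - r) +
        rightCoeff q σ σ' w ω M r i 0 (a - 1) 1 * r₁ (i + 1 + (a - 1) - r)) +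
      (q ^ a - w * ω) * (rightCoeff q σ σ' w ω M r i 1 a 0 * r₀ (i - 1 + a - r) +
        rightCoeff q σ σ' w ω M r i 1 a 1 * r₁ (i + a - r)) := by
  have e1 : 1 - w * σ ≠ 0 := sub_ne_zero.2 hw.symm
  have e2 : 1 - w * σ' ≠ 0 := sub_ne_zero.2 hw'.symm
  have eT : σ' / (σ' / ω) = ω := by field_simp
  have f1 : ∀ k, 1 - σ * q ^ k ≠ 0 := fun k => sub_ne_zero.2 (hσ k).symm
  have f2 : ∀ k, 1 - σ' * q ^ k ≠ 0 := fun k => sub_ne_zero.2 (hσ' k).symm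
  have f3 : ∀ k, 1 - q ^ (k + 1) ≠ 0 := fun k => sub_ne_zero.2 (hq _ (by omega)).symm
  have e3 : ∀ a, l₀ a = ((1 - w * σ' * q ^ a) * r₀ a - w * (ω - σ' * q ^ a) * r₁ (a + 1)) /
      (1 - w * σ') := fun a => by rw [← h₀]; field_simp
  have e4 : ∀ a, l₁ a = ((1 - q ^ a) * r₀ (a - 1) + (q ^ a - w * ω) * r₁ a) / (1 - w * σ') :=
    fun a => by rw [← h₁]; field_simp
  have n1 := labelNorm_ne_zero hq hσ'
  have g2 := qPoch_ne_zero hσ'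
  rw [e3, e4]
  rcases lt_trichotomy (r + 1) a with h | rfl | h
  · rw [leftCoeff_eq_zero (by omega), leftCoeff_eq_zero (by omega), rightCoeff_eq_zero (by omega),
      rightCoeff_eq_zero (by omega), rightCoeff_eq_zero (by omega), rightCoeff_eq_zero (by omega)]
    ring
  · have d := qHahnCoeff_diag_succ (T := σ' / ω) hq hσ' i
    rw [eT, ← eq_div_iff (f2 i)] at d
    rw [leftCoeff_eq_zero (δ := 1) (by omega), rightCoeff_eq_zero (ε := 1) (by omega),
      rightCoeff_eq_zero (ε := 1) (by omega),
      leftCoeff_eq (m := r + 1) (b := i) (by omega) (by omega),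
      rightCoeff_eq (n := i) (b := i) (by omega) (by omega),
      rightCoeff_eq (n := i + 1) (b := i + 1) (by omega) (by omega), if_pos le_rfl, if_pos le_rfl,
      show i + (r + 1 - 1) - r = i by omega, show i + (r + 1) - (r + 1) = i by omega,
      show i + 1 + (r + 1 - 1) - r = i + 1 by omega,
      hlWeight_zero_zero, hlWeight_one_zero, hlWeight_zero_one, d, labelNorm_succ, labelNorm_succ]
    have := n1 i
    have := f2 i
    have := f3 i
    have := f1 r
    generalize labelNorm q σ r = N
    generalize labelNorm q σ' i = N' at *
    generalize qHahnCoeff q (σ' / ω) σ' i i = C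
    simp only [← add_assoc, pow_succ, pow_zero] at *
    generalize σ ^ (M + i) = Z
    generalize q ^ i = y at *
    generalize q ^ r = y' at *
    have h2' : y * q - 1 = -(1 - y * q) := by ring
    rw [h2']
    generalize h2 : 1 - y * q = d2 at *
    field_simp
    ring
  · obtain ⟨p, rfl⟩ := Nat.exists_eq_add_of_le (Nat.lt_succ_iff.1 h)
    rcases lt_trichotomy p i with h | rfl | h
    · obtain ⟨l, rfl⟩ := Nat.exists_eq_add_of_lt h
      obtain ⟨C, c1, c2, c3, c4⟩ := qHahnCoeff_neighbours (T := σ' / ω) hq hσ' l p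
      rw [eT] at c1 c2 c4
      have hi : p + l + 1 = l + p + 1 := by omega
      have hi' : l + 1 + p = l + p + 1 := by omega
      rw [hi'] at c1 c2 c4
      rw [hi]
      -- At a = 0 the label a - 1 is meaningless, but its coefficient 1 - q^a vanishes. This gives
      -- one expression valid for every a.
      have hr : (1 - q ^ a) *
          (rightCoeff q σ σ' w ω M (a + p) (l + p + 1) 0 (a - 1) 0 *
            r₀ (l + p + 1 + (a - 1) - (a + p)) +
          rightCoeff q σ σ' w ω M (a + p) (l + p + 1) 0 (a - 1) 1 *
            r₁ (l + p + 1 + 1 + (a - 1) - (a + p))) =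
          (1 - q ^ a) * (labelNorm q σ (a + p) * ((1 - w * σ' * q ^ (l + p + 1)) / (1 - w * σ')) *
            qHahnCoeff q (σ' / ω) σ' (l + p + 1) l * (σ ^ (M + l))⁻¹ * r₀ l +
            labelNorm q σ (a + p) *
            (labelNorm q σ' (l + p + 1) / labelNorm q σ' (l + p + 1 + 1)) *
            ((q ^ (l + p + 1 + 1) - 1) * (w * σ') / (1 - w * σ')) *
            qHahnCoeff q (σ' / ω) σ' (l + p + 1 + 1) (l + 1) * (σ' ^ 1)⁻¹ *
            (σ ^ (M + (l + 1)))⁻¹ * σ ^ 1 * r₁ (l + 1)) := by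
        rcases a with _ | a
        · simp
        · rw [rightCoeff_eq (n := l + p + 1) (b := l) (by omega) (by omega),
            rightCoeff_eq (n := l + p + 1 + 1) (b := l + 1) (by omega) (by omega),
            if_pos (by omega), if_pos (by omega), hlWeight_zero_zero, hlWeight_zero_one,
            show l + p + 1 + (a + 1 - 1) - (a + 1 + p) = l by omega,
            show l + p + 1 + 1 + (a + 1 - 1) - (a + 1 + p) = l + 1 by omega,
            div_self (n1 _)]
          simp only [pow_zero, mul_one, inv_one]
      rw [hr, leftCoeff_eq (m := a + p + 1) (b := l) (by omega) (by omega),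
        leftCoeff_eq (m := a + p) (b := l + 1) (by omega) (by omega),
        rightCoeff_eq (ε := 1) (n := l + p) (b := l) (by omega) (by omega),
        rightCoeff_eq (ε := 1) (δ := 1) (n := l + p + 1) (b := l + 1) (by omega) (by omega),
        if_pos (by omega), if_pos (by omega), if_pos (by omega),
        c1, c2, c3, c4, show l + p + 1 + a - (a + p + 1) = l by omega,
        show l + p + 1 + a - (a + p) = l + 1 by omega,
        show l + p + 1 - 1 + a - (a + p) = l by omega,
        hlWeight_one_zero, hlWeight_one_one,
        hlWeight_one_zero, hlWeight_one_one, labelNorm_succ, labelNorm_succ, labelNorm_succ,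
        labelNorm_succ, Nat.add_sub_cancel]
      have := n1 (l + p)
      have := f2 (l + p)
      have := f3 (l + p)
      have := f2 (l + p + 1)
      have := f3 (l + p + 1)
      have := f1 (a + p)
      generalize labelNorm q σ (a + p) = N
      generalize labelNorm q σ' (l + p) = N' at *
      clear c1 c2 c3 c4 e3 e4 h₀ h₁ n1 g2 f1 f2 f3 hr
      simp only [← add_assoc, pow_succ, pow_zero, pow_add q a p, pow_add q l p] at *
      generalize σ ^ (M + l) = Z
      generalize q ^ p = x at *
      generalize q ^ l = y at *
      generalize q ^ a = z at *
      generalize r₀ l = R₀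
      generalize r₁ (l + 1) = R₁
      generalize h1 : 1 - σ' * (y * x) = d1 at *
      generalize h2 : 1 - y * x * q = d2 at *
      generalize h3 : 1 - σ' * (y * x * q) = d3 at *
      generalize h4 : 1 - y * x * q * q = d4 at *
      generalize h5 : 1 - σ * (z * x) = d5 at *
      generalize h6 : 1 - w * σ = d6 at *
      generalize h7 : 1 - w * σ' = d7 at *
      have h4' : y * x * q * q - 1 = -d4 := by rw [← h4]; ring
      rw [h4']
      field_simp
      subst h1 h2 h3 h4 h5 h6 h7
      ring
    · have z : rightCoeff q σ σ' w ω M (a + p) p 1 a 0 = 0 := by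
        rcases p with _ | p
        · exact rightCoeff_eq_zero_of_lt (by omega)
        · exact rightCoeff_eq_zero (by omega)
      have hr : (1 - q ^ a) *
          (rightCoeff q σ σ' w ω M (a + p) p 0 (a - 1) 0 * r₀ (p + (a - 1) - (a + p)) +
          rightCoeff q σ σ' w ω M (a + p) p 0 (a - 1) 1 * r₁ (p + 1 + (a - 1) - (a + p))) =
          (1 - q ^ a) * (labelNorm q σ (a + p) * (labelNorm q σ' p / labelNorm q σ' (p + 1)) *
            ((q ^ (p + 1) - 1) * (w * σ') / (1 - w * σ')) *
            qHahnCoeff q (σ' / ω) σ' (p + 1) 0 * (σ' ^ 1)⁻¹ *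
            (σ ^ (M + 0))⁻¹ * σ ^ 1 * r₁ 0) := by
        rcases a with _ | a
        · simp
        · rw [rightCoeff_eq_zero (δ := 0) (by omega),
            rightCoeff_eq (n := p + 1) (b := 0) (by omega) (by omega),
            if_pos (by omega), hlWeight_zero_one, zero_mul, zero_add,
            show p + 1 + (a + 1 - 1) - (a + 1 + p) = 0 by omega]
      rw [hr, z, leftCoeff_eq_zero (δ := 0) (by omega),
        leftCoeff_eq (m := a + p) (b := 0) (by omega) (by omega),
        rightCoeff_eq (ε := 1) (δ := 1) (n := p) (b := 0) (by omega) (by omega),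
        if_pos (Nat.zero_le p), show p + a - (a + p) = 0 by omega,
        hlWeight_one_one, hlWeight_one_one,
        qHahnCoeff_zero_right hq, qHahnCoeff_zero_right hq, eT, labelNorm_succ, qPoch_succ,
        qPoch_succ]
      have := n1 p
      have := f2 p
      have := f3 p
      have := g2 p
      generalize labelNorm q σ (a + p) = N
      generalize labelNorm q σ' p = N' at *
      generalize qPoch q σ' p = G at *
      generalize qPoch q ω p = C
      clear hr
      simp only [pow_succ, pow_zero, pow_add q a p] at *
      generalize σ ^ (M + 0) = Z
      generalize q ^ p = y at *
      generalize q ^ a = y' at *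
      rw [← mul_assoc σ] at *
      field_simp
      ring
    · have z : (1 - q ^ a) *
          (rightCoeff q σ σ' w ω M (a + p) i 0 (a - 1) 0 * r₀ (i + (a - 1) - (a + p)) +
          rightCoeff q σ σ' w ω M (a + p) i 0 (a - 1) 1 * r₁ (i + 1 + (a - 1) - (a + p))) = 0 := by
        rcases a with _ | a
        · simp
        · rw [rightCoeff_eq_zero (by omega), rightCoeff_eq_zero (by omega)]
          ring
      rw [z, leftCoeff_eq_zero (by omega), leftCoeff_eq_zero (by omega),
        rightCoeff_eq_zero (by omega), rightCoeff_eq_zero (by omega)]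
      ring

end local_relation

/-! ### Rows of vertices -/

/-- The weight of a row of `L` vertices with left label `a`, right label `0`, bottom labels `bot`
and top labels `top`; the horizontal labels are determined by the conservation law. -/
def rowWeight : (L : ℕ) → (ℕ → ℕ → ℕ → ℕ → ℕ → ℂ) → ℕ → (Fin L → ℕ) → (Fin L → ℕ) → ℂ
  | 0, _, a, _, _ => if a = 0 then 1 else 0
  | L + 1, wt, a, bot, top =>
    wt 0 (bot 0) a (top 0) (bot 0 + a - top 0) *
      rowWeight L (fun j => wt (j + 1)) (bot 0 + a - top 0) (Fin.tail bot) (Fin.tail top)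

/-- The conservation law. -/
def Conserves (wt : ℕ → ℕ → ℕ → ℕ → ℕ → ℂ) : Prop :=
  ∀ c i j k l, wt c i j k l ≠ 0 → i + j = k + l

theorem Conserves.succ {wt : ℕ → ℕ → ℕ → ℕ → ℕ → ℂ} (h : Conserves wt) :
    Conserves fun c => wt (c + 1) := fun c => h (c + 1)

/-- Conservation telescopes along the row, and nothing leaves on the right. As the labels of λ sum
to λ_1, the left label is the growth of λ_1. The finiteness and support bounds below rest on this.
-/
theorem sum_add_eq_of_rowWeight_ne_zero {L : ℕ} {wt : ℕ → ℕ → ℕ → ℕ → ℕ → ℂ} (hwt : Conserves wt)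
    {a : ℕ} {bot top : Fin L → ℕ} (h : rowWeight L wt a bot top ≠ 0) :
    ∑ j, bot j + a = ∑ j, top j := by
  induction L generalizing wt a with
  | zero =>
    simp only [rowWeight] at h
    split_ifs at h with h'
    · simp [h']
    · exact absurd rfl h
  | succ L ih =>
    rw [rowWeight] at h
    have h1 := hwt _ _ _ _ _ (left_ne_zero_of_mul h)
    have h2 := ih hwt.succ (right_ne_zero_of_mul h)
    rw [Fin.sum_univ_succ, Fin.sum_univ_succ]
    simp only [Fin.tail] at h2
    omega

theorem finite_sum_le (L K : ℕ) : {t : Fin L → ℕ | ∑ j, t j ≤ K}.Finite := by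
  refine (Set.finite_Iic (fun _ : Fin L => K)).subset fun t ht j => ?_
  exact (Finset.single_le_sum (f := t) (fun _ _ => Nat.zero_le _) (Finset.mem_univ j)).trans ht

theorem finsum_fin_succ {L : ℕ} (F : (Fin (L + 1) → ℕ) → ℂ) (hF : (Function.support F).Finite) :
    ∑ᶠ t, F t = ∑ᶠ m, ∑ᶠ t, F (Fin.cons m t) := by
  rw [← finsum_comp_equiv (Fin.consEquiv fun _ => ℕ), finsum_curry]
  · rfl
  · exact hF.preimage (Fin.consEquiv fun _ => ℕ).injective.injOn

theorem finsum_nat_two_terms (f : ℕ → ℂ) (s : ℕ) (hf : ∀ m, f m ≠ 0 → m = s ∨ m + 1 = s) :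
    ∑ᶠ m, f m = f s + if s = 0 then 0 else f (s - 1) := by
  rcases s with _ | s
  · rw [finsum_eq_single f 0 fun m hm => by_contra fun h => by have := hf m h; omega]
    simp
  · rw [finsum_eq_sum_of_support_subset (s := {s + 1, s}) f, Finset.sum_pair (by omega)]
    · simp
    · intro m hm
      have := hf m hm
      simp
      omega

theorem finsum_comm_of_finite {α β : Type*} (f : α → β → ℂ)
    (hf : (Function.support fun p : α × β => f p.1 p.2).Finite) :
    ∑ᶠ a, ∑ᶠ b, f a b = ∑ᶠ b, ∑ᶠ a, f a b := by
  rw [← finsum_curry (fun p : α × β => f p.1 p.2) hf,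
    ← finsum_comp_equiv (Equiv.prodComm β α), finsum_curry]
  · rfl
  · exact hf.preimage (Equiv.prodComm β α).injective.injOn

/-- The weights of the columns of a `w`-row. -/
def hlCols (q u : ℂ) (A B : ℕ → ℂ) (j : ℕ) : ℕ → ℕ → ℕ → ℕ → ℂ :=
  hlWeight q (u * A (j + 1)) (A (j + 1) * B (j + 1))

/-- The weights of the columns of a `W`-row. -/
def qHahnCols (q κ : ℂ) (A B : ℕ → ℂ) (j : ℕ) : ℕ → ℕ → ℕ → ℕ → ℂ :=
  qHahnWeight q (A (j + 2) / κ) (A (j + 2) * B (j + 1))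

/-- The sequence `A` without its first entry. -/
def shift (A : ℕ → ℂ) (k : ℕ) : ℂ := A (k + 1)

theorem conserves_hlCols (q u : ℂ) (A B : ℕ → ℂ) : Conserves (hlCols q u A B) :=
  fun _ _ _ _ _ h => (hlWeight_conserve h).1

theorem conserves_qHahnCols (q κ : ℂ) (A B : ℕ → ℂ) : Conserves (qHahnCols q κ A B) :=
  fun _ _ _ _ _ h => (qHahnWeight_conserve h).1

/-- The factor `∏_{k ≥ 2} (A_{k-1} B_{k-1})^{-λ_k} ∏_{k ≥ 1} (q;q)_{m_k} / (A_k B_k;q)_{m_k}`, where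
`m` lists the differences `m_k = λ_k - λ_{k+1}`. -/
def partitionNorm (q : ℂ) : (L : ℕ) → (ℕ → ℂ) → (ℕ → ℂ) → (Fin L → ℕ) → ℂ
  | 0, _, _, _ => 1
  | L + 1, A, B, m =>
    labelNorm q (A 1 * B 1) (m 0) * ((A 1 * B 1) ^ (∑ j, Fin.tail m j))⁻¹ *
      partitionNorm q L (shift A) (shift B) (Fin.tail m)

/-- A `w`-row with bottom labels `ρ` and a `W`-row with bottom labels `μ`, with their top edges
glued together. -/
def leftSum (q u κ : ℂ) (L : ℕ) (A B : ℕ → ℂ) (ρ μ : Fin L → ℕ) (ε a : ℕ) : ℂ :=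
  ∑ᶠ t : Fin L → ℕ, partitionNorm q L A B t * rowWeight L (hlCols q u A B) ε ρ t *
    rowWeight L (qHahnCols q κ A B) a μ t

/-- A `w`-row with top labels `μ` and a `W`-row with top labels `ρ`, with their bottom edges
glued together. -/
def rightSum (q u κ : ℂ) (L : ℕ) (A B : ℕ → ℂ) (ρ μ : Fin L → ℕ) (ε a : ℕ) : ℂ :=
  ∑ᶠ t : Fin L → ℕ, partitionNorm q L A B ρ *
    (partitionNorm q L (shift A) B μ / partitionNorm q L (shift A) B t) *
    rowWeight L (hlCols q u (shift A) B) ε t μ * rowWeight L (qHahnCols q κ A B) a t ρ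

/-! ### Splitting off the first column -/

/-- A w-vertex emits 0 or 1, so the first glued label has two possible values. The norm couples the
first column to the rest only through the sum of the remaining t; conservation in the remaining
W-row replaces it by a quantity independent of t, which is why `leftCoeff` carries the exponent M +
b. -/
theorem leftSum_succ {q u κ : ℂ} {L : ℕ} {A B : ℕ → ℂ} (hB : B 1 ≠ 0) (hκ : κ ≠ 0)
    (ρ μ : Fin (L + 1) → ℕ) (ε a : ℕ) :
    leftSum q u κ (L + 1) A B ρ μ ε a =
      leftCoeff q (A 1 * B 1) (A 2 * B 1) (u / B 1) (κ * B 1) (∑ j, Fin.tail μ j) (ρ 0) (μ 0) ε a 0 *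
        leftSum q u κ L (shift A) (shift B) (Fin.tail ρ) (Fin.tail μ) 0 (μ 0 + a - (ρ 0 + ε)) +
      leftCoeff q (A 1 * B 1) (A 2 * B 1) (u / B 1) (κ * B 1) (∑ j, Fin.tail μ j) (ρ 0) (μ 0) ε a 1 *
        leftSum q u κ L (shift A) (shift B) (Fin.tail ρ) (Fin.tail μ) 1
          (μ 0 + a - (ρ 0 + ε - 1)) := by
  have e1 : u / B 1 * (A 1 * B 1) = u * A 1 := by field_simp
  have e2 : A 2 * B 1 / (κ * B 1) = A 2 / κ := by field_simp
  rw [leftSum, finsum_fin_succ]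
  swap
  · refine (finite_sum_le _ (∑ j, ρ j + ε)).subset fun t ht => ?_
    exact (sum_add_eq_of_rowWeight_ne_zero (conserves_hlCols _ _ _ _)
      (right_ne_zero_of_mul (left_ne_zero_of_mul ht))).ge
  have key : ∀ m : ℕ, ∑ᶠ t : Fin L → ℕ, partitionNorm q (L + 1) A B (Fin.cons m t) *
      rowWeight (L + 1) (hlCols q u A B) ε ρ (Fin.cons m t) *
      rowWeight (L + 1) (qHahnCols q κ A B) a μ (Fin.cons m t) =
      labelNorm q (A 1 * B 1) m * hlWeight q (u * A 1) (A 1 * B 1) (ρ 0) ε m (ρ 0 + ε - m) *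
      qHahnWeight q (A 2 / κ) (A 2 * B 1) (μ 0) a m (μ 0 + a - m) *
      ((A 1 * B 1) ^ (∑ j, Fin.tail μ j + (μ 0 + a - m)))⁻¹ *
      leftSum q u κ L (shift A) (shift B) (Fin.tail ρ) (Fin.tail μ) (ρ 0 + ε - m)
        (μ 0 + a - m) := by
    intro m
    rw [leftSum, mul_finsum]
    refine finsum_congr fun t => ?_
    have h1 : rowWeight (L + 1) (qHahnCols q κ A B) a μ (Fin.cons m t) =
      qHahnWeight q (A 2 / κ) (A 2 * B 1) (μ 0) a m (μ 0 + a - m) *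
      rowWeight L (qHahnCols q κ (shift A) (shift B)) (μ 0 + a - m) (Fin.tail μ) t := rfl
    have h2 : rowWeight (L + 1) (hlCols q u A B) ε ρ (Fin.cons m t) =
      hlWeight q (u * A 1) (A 1 * B 1) (ρ 0) ε m (ρ 0 + ε - m) *
      rowWeight L (hlCols q u (shift A) (shift B)) (ρ 0 + ε - m) (Fin.tail ρ) t := rfl
    have h3 : partitionNorm q (L + 1) A B (Fin.cons m t) =
      labelNorm q (A 1 * B 1) m * ((A 1 * B 1) ^ (∑ j, t j))⁻¹ *
      partitionNorm q L (shift A) (shift B) t := rfl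
    rw [h1, h2, h3]
    by_cases hz : rowWeight L (qHahnCols q κ (shift A) (shift B)) (μ 0 + a - m) (Fin.tail μ) t = 0
    · rw [hz]; ring
    · rw [sum_add_eq_of_rowWeight_ne_zero (conserves_qHahnCols _ _ _ _) hz]
      ring
  simp_rw [key]
  rw [finsum_nat_two_terms _ (ρ 0 + ε)]
  · congr 1
    · simp only [leftCoeff, e1, e2, Nat.sub_zero, Nat.sub_self]
    · split_ifs with h
      · rw [leftCoeff_eq_zero_of_lt (by omega), zero_mul]
      · rw [leftCoeff, e1, e2, show ρ 0 + ε - (ρ 0 + ε - 1) = 1 by omega]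
  · intro m hm
    have := hlWeight_conserve (right_ne_zero_of_mul (left_ne_zero_of_mul
      (left_ne_zero_of_mul (left_ne_zero_of_mul hm))))
    omega

/-- Again two glued labels occur. Here both remaining rows are needed: the sums over the tails of ρ
and μ exceed that of t by the W-label and the w-label respectively, and the resulting powers are
those in `rightCoeff`. -/
theorem rightSum_succ {q u κ : ℂ} {L : ℕ} {A B : ℕ → ℂ} (hA : A 1 ≠ 0) (hA2 : A 2 ≠ 0)
    (hB : B 1 ≠ 0) (hκ : κ ≠ 0) (ρ μ : Fin (L + 1) → ℕ) (ε a : ℕ) (hε : ε ≤ 1) :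
    rightSum q u κ (L + 1) A B ρ μ ε a =
      rightCoeff q (A 1 * B 1) (A 2 * B 1) (u / B 1) (κ * B 1) (∑ j, Fin.tail μ j) (ρ 0) (μ 0) ε a 0 *
        rightSum q u κ L (shift A) (shift B) (Fin.tail ρ) (Fin.tail μ) 0 (μ 0 - ε + a - ρ 0) +
      rightCoeff q (A 1 * B 1) (A 2 * B 1) (u / B 1) (κ * B 1) (∑ j, Fin.tail μ j) (ρ 0) (μ 0) ε a 1 *
        rightSum q u κ L (shift A) (shift B) (Fin.tail ρ) (Fin.tail μ) 1
          (μ 0 + 1 - ε + a - ρ 0) := by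
  have e1 : u / B 1 * (A 2 * B 1) = u * A 2 := by field_simp
  have e2 : A 2 * B 1 / (κ * B 1) = A 2 / κ := by field_simp
  have e3 : A 1 * B 1 ≠ 0 := mul_ne_zero hA hB
  have e4 : A 2 * B 1 ≠ 0 := mul_ne_zero hA2 hB
  rw [rightSum, finsum_fin_succ]
  swap
  · refine (finite_sum_le _ (∑ j, μ j)).subset fun t ht => ?_
    have := (sum_add_eq_of_rowWeight_ne_zero (conserves_hlCols _ _ _ _)
      (right_ne_zero_of_mul (left_ne_zero_of_mul ht)))
    simp only [Set.mem_ofPred_eq]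
    omega
  have key : ∀ m : ℕ, ∑ᶠ t : Fin L → ℕ, partitionNorm q (L + 1) A B ρ *
      (partitionNorm q (L + 1) (shift A) B μ /
        partitionNorm q (L + 1) (shift A) B (Fin.cons m t)) *
      rowWeight (L + 1) (hlCols q u (shift A) B) ε (Fin.cons m t) μ *
      rowWeight (L + 1) (qHahnCols q κ A B) a (Fin.cons m t) ρ =
      labelNorm q (A 1 * B 1) (ρ 0) * (labelNorm q (A 2 * B 1) (μ 0) / labelNorm q (A 2 * B 1) m) *
      hlWeight q (u * A 2) (A 2 * B 1) m ε (μ 0) (m + ε - μ 0) *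
      qHahnWeight q (A 2 / κ) (A 2 * B 1) m a (ρ 0) (m + a - ρ 0) *
      ((A 2 * B 1) ^ (m + ε - μ 0))⁻¹ *
      ((A 1 * B 1) ^ (∑ j, Fin.tail μ j + (m + a - ρ 0)))⁻¹ * (A 1 * B 1) ^ (m + ε - μ 0) *
      rightSum q u κ L (shift A) (shift B) (Fin.tail ρ) (Fin.tail μ) (m + ε - μ 0)
        (m + a - ρ 0) := by
    intro m
    rw [rightSum, mul_finsum]
    refine finsum_congr fun t => ?_
    have h1 : rowWeight (L + 1) (qHahnCols q κ A B) a (Fin.cons m t) ρ =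
      qHahnWeight q (A 2 / κ) (A 2 * B 1) m a (ρ 0) (m + a - ρ 0) *
      rowWeight L (qHahnCols q κ (shift A) (shift B)) (m + a - ρ 0) t (Fin.tail ρ) := rfl
    have h2 : rowWeight (L + 1) (hlCols q u (shift A) B) ε (Fin.cons m t) μ =
      hlWeight q (u * A 2) (A 2 * B 1) m ε (μ 0) (m + ε - μ 0) *
      rowWeight L (hlCols q u (shift (shift A)) (shift B)) (m + ε - μ 0) t (Fin.tail μ) := rfl
    have h3 : partitionNorm q (L + 1) (shift A) B (Fin.cons m t) =
      labelNorm q (A 2 * B 1) m * ((A 2 * B 1) ^ (∑ j, t j))⁻¹ *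
      partitionNorm q L (shift (shift A)) (shift B) t := rfl
    have h4 : partitionNorm q (L + 1) (shift A) B μ =
      labelNorm q (A 2 * B 1) (μ 0) * ((A 2 * B 1) ^ (∑ j, Fin.tail μ j))⁻¹ *
      partitionNorm q L (shift (shift A)) (shift B) (Fin.tail μ) := rfl
    have h5 : partitionNorm q (L + 1) A B ρ =
      labelNorm q (A 1 * B 1) (ρ 0) * ((A 1 * B 1) ^ (∑ j, Fin.tail ρ j))⁻¹ *
      partitionNorm q L (shift A) (shift B) (Fin.tail ρ) := rfl
    rw [h1, h2, h3, h4, h5]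
    by_cases hz : rowWeight L (qHahnCols q κ (shift A) (shift B)) (m + a - ρ 0) t (Fin.tail ρ) = 0
    · rw [hz]; ring
    by_cases hz' : rowWeight L (hlCols q u (shift (shift A)) (shift B)) (m + ε - μ 0) t
        (Fin.tail μ) = 0
    · rw [hz']; ring
    rw [← sum_add_eq_of_rowWeight_ne_zero (conserves_qHahnCols _ _ _ _) hz,
      ← sum_add_eq_of_rowWeight_ne_zero (conserves_hlCols _ _ _ _) hz']
    generalize m + a - ρ 0 = b
    generalize m + ε - μ 0 = δ
    simp only [pow_add]
    have i1 := pow_ne_zero (∑ j, t j) e3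
    have i2 := pow_ne_zero (∑ j, t j) e4
    have i3 := pow_ne_zero b e3
    have i4 := pow_ne_zero δ e3
    have i5 := pow_ne_zero δ e4
    generalize (A 1 * B 1) ^ (∑ j, t j) = x1 at *
    generalize (A 2 * B 1) ^ (∑ j, t j) = x2 at *
    generalize (A 1 * B 1) ^ b = x3 at *
    generalize (A 1 * B 1) ^ δ = x4 at *
    generalize (A 2 * B 1) ^ δ = x5 at *
    simp only [div_eq_mul_inv, mul_inv, inv_inv]
    field_simp
  simp_rw [key]
  rw [finsum_nat_two_terms _ (μ 0 + 1 - ε), add_comm]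
  · congr 1
    · split_ifs with h
      · rw [rightCoeff_eq_zero_of_lt (by omega), zero_mul]
      · rw [rightCoeff, e1, e2, show μ 0 + 1 - ε - 1 = μ 0 - ε by omega,
          show μ 0 - ε + ε - μ 0 = 0 by omega]
        simp only [Nat.add_zero]
    · rw [rightCoeff, e1, e2, show μ 0 + 1 - ε + ε - μ 0 = 1 by omega]
  · intro m hm
    have h1 : hlWeight q (u * A 2) (A 2 * B 1) m ε (μ 0) (m + ε - μ 0) ≠ 0 :=
      fun h => hm (by simp [h])
    have := hlWeight_conserve h1
    omega

theorem leftSum_zero (q u κ : ℂ) (A B : ℕ → ℂ) (ρ μ : Fin 0 → ℕ) (ε a : ℕ) :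
    leftSum q u κ 0 A B ρ μ ε a = (if ε = 0 then 1 else 0) * if a = 0 then 1 else 0 := by
  rw [leftSum, finsum_unique, partitionNorm, one_mul, rowWeight, rowWeight]

theorem rightSum_zero (q u κ : ℂ) (A B : ℕ → ℂ) (ρ μ : Fin 0 → ℕ) (ε a : ℕ) :
    rightSum q u κ 0 A B ρ μ ε a = (if ε = 0 then 1 else 0) * if a = 0 then 1 else 0 := by
  rw [rightSum, finsum_unique]
  simp only [partitionNorm, rowWeight, div_one, one_mul]

/-- The exchange relation between a `w`-row and a `W`-row. -/
theorem exchange {q u κ : ℂ} (hq : ∀ r : ℕ, 1 ≤ r → q ^ r ≠ 1) (hκ : κ ≠ 0) {L : ℕ} {A B : ℕ → ℂ}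
    (hA : ∀ j, A j ≠ 0) (hB : ∀ j, B j ≠ 0)
    (hσ : ∀ j r : ℕ, A (j + 1) * B (j + 1) * q ^ r ≠ 1)
    (hσ' : ∀ j r : ℕ, A (j + 2) * B (j + 1) * q ^ r ≠ 1) (hu : ∀ j, u * A (j + 1) ≠ 1)
    (ρ μ : Fin (L + 1) → ℕ) (hμ : μ (Fin.last L) = 0) :
    (∀ D, (1 - u * A 1) * leftSum q u κ (L + 1) A B ρ μ 0 D =
      (1 - u * A 1 * q ^ D) * rightSum q u κ (L + 1) A B ρ μ 0 D -
        u * (κ - A 1 * q ^ D) * rightSum q u κ (L + 1) A B ρ μ 1 (D + 1)) ∧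
    ∀ a, (1 - u * A 1) * leftSum q u κ (L + 1) A B ρ μ 1 a =
      (1 - q ^ a) * rightSum q u κ (L + 1) A B ρ μ 0 (a - 1) +
        (q ^ a - u * κ) * rightSum q u κ (L + 1) A B ρ μ 1 a := by
  induction L generalizing A B with
  | zero =>
    have hB1 := hB 1
    have e1 : u / B 1 * (A 1 * B 1) = u * A 1 := by field_simp
    have e2 : u / B 1 * (A 2 * B 1) = u * A 2 := by field_simp
    have e3 : u / B 1 * (κ * B 1) = u * κ := by field_simp
    have e4 : ∀ x y : ℂ, u / B 1 * (κ * B 1 - x * B 1 * y) = u * (κ - x * y) := fun x y => by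
      field_simp
    have h2 : 1 - u * A 2 ≠ 0 := sub_ne_zero.2 (hu 1).symm
    have hμ0 : μ 0 = 0 := hμ
    -- With no columns left the genuine sums do not satisfy the ε = 1 relation at a = 1. The value
    -- l₁(1) = (1 - q)/(1 - uA_2) is chosen to make it hold.
    have s0 := exchange_step_zero hq (mul_ne_zero (hA 1) hB1) (mul_ne_zero (hA 2) hB1)
      (mul_ne_zero hκ hB1) (hσ 0) (hσ' 0) (by rw [e1]; exact hu 0) (by rw [e2]; exact hu 1)
      (l₀ := fun a => if a = 0 then 1 else 0) (r₀ := fun a => if a = 0 then 1 else 0)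
      (l₁ := fun a => if a = 1 then (1 - q) / (1 - u * A 2) else 0) (r₁ := fun _ => 0)
      (fun D => by rw [e2]; rcases D with _ | D <;> simp)
      (fun a => by
        rw [e2]
        rcases a with _ | _ | a
        · simp
        · simp [mul_div_cancel₀ _ h2]
        · simp)
      (∑ j, Fin.tail μ j) (ρ 0) (μ 0)
    have s1 := exchange_step_one hq (mul_ne_zero (hA 1) hB1) (mul_ne_zero (hA 2) hB1)
      (mul_ne_zero hκ hB1) (hσ 0) (hσ' 0) (by rw [e1]; exact hu 0) (by rw [e2]; exact hu 1)
      (l₀ := fun a => if a = 0 then 1 else 0) (r₀ := fun a => if a = 0 then 1 else 0)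
      (l₁ := fun a => if a = 1 then (1 - q) / (1 - u * A 2) else 0) (r₁ := fun _ => 0)
      (fun D => by rw [e2]; rcases D with _ | D <;> simp)
      (fun a => by
        rw [e2]
        rcases a with _ | _ | a
        · simp
        · simp [mul_div_cancel₀ _ h2]
        · simp)
      (∑ j, Fin.tail μ j) (ρ 0) (μ 0)
    simp only [e1, e3, e4] at s0 s1
    refine ⟨fun D => ?_, fun a => ?_⟩
    · have h := s0 D
      rw [leftSum_succ hB1 hκ, rightSum_succ (hA 1) (hA 2) hB1 hκ _ _ _ _ (by omega),
        rightSum_succ (hA 1) (hA 2) hB1 hκ _ _ _ _ (by omega)]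
      -- The artificial value is never seen: the last label of μ is 0, and a W-vertex with bottom
      -- label 0 cannot emit 1.
      have z : leftCoeff q (A 1 * B 1) (A 2 * B 1) (u / B 1) (κ * B 1) (∑ j, Fin.tail μ j) (ρ 0)
          (μ 0) 0 D 1 * (if μ 0 + D - (ρ 0 - 1) = 1 then (1 - q) / (1 - u * A 2) else 0) = 0 := by
        split_ifs with hc
        · rcases Nat.eq_zero_or_pos (ρ 0) with h0 | h0
          · rw [leftCoeff_eq_zero_of_lt (by omega), zero_mul]
          · rw [leftCoeff_eq_zero (by omega), zero_mul]
        · rw [mul_zero]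
      rw [z] at h
      simpa [leftSum_zero, rightSum_zero] using h
    · have h := s1 a
      rw [leftSum_succ hB1 hκ, rightSum_succ (hA 1) (hA 2) hB1 hκ _ _ _ _ (by omega),
        rightSum_succ (hA 1) (hA 2) hB1 hκ _ _ _ _ (by omega)]
      have z : leftCoeff q (A 1 * B 1) (A 2 * B 1) (u / B 1) (κ * B 1) (∑ j, Fin.tail μ j) (ρ 0)
          (μ 0) 1 a 1 * (if μ 0 + a - ρ 0 = 1 then (1 - q) / (1 - u * A 2) else 0) = 0 := by
        split_ifs with hc
        · rw [leftCoeff_eq_zero (by omega), zero_mul]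
        · rw [mul_zero]
      rw [z] at h
      simpa [leftSum_zero, rightSum_zero] using h
  | succ L ih =>
    obtain ⟨h₀, h₁⟩ := ih (A := shift A) (B := shift B) (fun j => hA _) (fun j => hB _)
      (fun j => hσ _) (fun j => hσ' _) (fun j => hu _) (Fin.tail ρ) (Fin.tail μ) hμ
    have hB1 := hB 1
    have e1 : u / B 1 * (A 1 * B 1) = u * A 1 := by field_simp
    have e2 : u / B 1 * (A 2 * B 1) = u * A 2 := by field_simp
    have e3 : u / B 1 * (κ * B 1) = u * κ := by field_simp
    have e4 : ∀ x y : ℂ, u / B 1 * (κ * B 1 - x * B 1 * y) = u * (κ - x * y) := fun x y => by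
      field_simp
    have s0 := exchange_step_zero hq (mul_ne_zero (hA 1) hB1) (mul_ne_zero (hA 2) hB1)
      (mul_ne_zero hκ hB1) (hσ 0) (hσ' 0) (by rw [e1]; exact hu 0) (by rw [e2]; exact hu 1)
      (fun D => by rw [e2, e4]; exact h₀ D) (fun a => by rw [e2, e3]; exact h₁ a)
      (∑ j, Fin.tail μ j) (ρ 0) (μ 0)
    have s1 := exchange_step_one hq (mul_ne_zero (hA 1) hB1) (mul_ne_zero (hA 2) hB1)
      (mul_ne_zero hκ hB1) (hσ 0) (hσ' 0) (by rw [e1]; exact hu 0) (by rw [e2]; exact hu 1)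
      (fun D => by rw [e2, e4]; exact h₀ D) (fun a => by rw [e2, e3]; exact h₁ a)
      (∑ j, Fin.tail μ j) (ρ 0) (μ 0)
    simp only [e1, e3, e4] at s0 s1
    refine ⟨fun D => ?_, fun a => ?_⟩
    · have := s0 D
      rw [leftSum_succ hB1 hκ, rightSum_succ (hA 1) (hA 2) hB1 hκ _ _ _ _ (by omega),
        rightSum_succ (hA 1) (hA 2) hB1 hκ _ _ _ _ (by omega)]
      simpa using this
    · have := s1 a
      rw [leftSum_succ hB1 hκ, rightSum_succ (hA 1) (hA 2) hB1 hκ _ _ _ _ (by omega),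
        rightSum_succ (hA 1) (hA 2) hB1 hκ _ _ _ _ (by omega)]
      simpa using this

/-! ### One-row operators -/

/-- The weight of the left edge of a `W`-row. -/
def leftWeight (q κ : ℂ) (A B : ℕ → ℂ) (a : ℕ) : ℂ :=
  (κ * B 0) ^ a * (qPoch q (A 1 / κ) a / qPoch q q a)

/-- A `w`-row summed over its left label. -/
def hlRow (q u : ℂ) (L : ℕ) (A B : ℕ → ℂ) (bot top : Fin L → ℕ) : ℂ :=
  ∑ ε : Fin 2, (-(u * A 0)) ^ (ε : ℕ) * rowWeight L (hlCols q u A B) ε bot top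

/-- A `W`-row summed over its left label. -/
def qHahnRow (q κ : ℂ) (L : ℕ) (A B : ℕ → ℂ) (bot top : Fin L → ℕ) : ℂ :=
  ∑ᶠ a, leftWeight q κ A B a * rowWeight L (qHahnCols q κ A B) a bot top

/-- The normalization `∏_{k ≥ 1} (A_{k-1} B_{k-1})^{-λ_k} (q;q)_{m_k} / (A_k B_k;q)_{m_k}`. -/
def fullNorm (q : ℂ) (L : ℕ) (A B : ℕ → ℂ) (m : Fin L → ℕ) : ℂ :=
  ((A 0 * B 0) ^ (∑ j, m j))⁻¹ * partitionNorm q L A B m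

theorem qHahnRow_eq {q κ : ℂ} {L : ℕ} {A B : ℕ → ℂ} {bot top : Fin L → ℕ} {a : ℕ}
    (h : ∑ j, bot j + a = ∑ j, top j) :
    qHahnRow q κ L A B bot top =
      leftWeight q κ A B a * rowWeight L (qHahnCols q κ A B) a bot top := by
  refine finsum_eq_single _ a fun b hb => ?_
  by_contra h'
  have := sum_add_eq_of_rowWeight_ne_zero (conserves_qHahnCols _ _ _ _) (right_ne_zero_of_mul h')
  omega

theorem sum_le_of_qHahnRow_ne_zero {q κ : ℂ} {L : ℕ} {A B : ℕ → ℂ} {bot top : Fin L → ℕ}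
    (h : qHahnRow q κ L A B bot top ≠ 0) : ∑ j, bot j ≤ ∑ j, top j := by
  by_contra h'
  refine h (finsum_eq_zero_of_forall_eq_zero fun a => by_contra fun ha => h' ?_)
  have := sum_add_eq_of_rowWeight_ne_zero (conserves_qHahnCols _ _ _ _) (right_ne_zero_of_mul ha)
  omega

theorem sum_le_of_hlRow_ne_zero {q u : ℂ} {L : ℕ} {A B : ℕ → ℂ} {bot top : Fin L → ℕ}
    (h : hlRow q u L A B bot top ≠ 0) :
    ∑ j, bot j ≤ ∑ j, top j ∧ ∑ j, top j ≤ ∑ j, bot j + 1 := by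
  obtain ⟨ε, -, hε⟩ := Finset.exists_ne_zero_of_sum_ne_zero h
  have := sum_add_eq_of_rowWeight_ne_zero (conserves_hlCols _ _ _ _) (right_ne_zero_of_mul hε)
  have := ε.2
  omega

/-- For fixed ε, conservation in the w-row fixes the total of t, hence the left label of the W-row
and the power of A_0 B_0, which leave the sum. -/
theorem finsum_left_eq (q u κ : ℂ) {L : ℕ} (A B : ℕ → ℂ) (ρ μ : Fin L → ℕ) (ε : ℕ) :
    ∑ᶠ t, fullNorm q L A B t * rowWeight L (hlCols q u A B) ε ρ t * qHahnRow q κ L A B μ t =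
      if ∑ j, μ j ≤ ∑ j, ρ j + ε then ((A 0 * B 0) ^ (∑ j, ρ j + ε))⁻¹ *
        leftWeight q κ A B (∑ j, ρ j + ε - ∑ j, μ j) *
        leftSum q u κ L A B ρ μ ε (∑ j, ρ j + ε - ∑ j, μ j) else 0 := by
  split_ifs with h
  · rw [leftSum, mul_finsum]
    refine finsum_congr fun t => ?_
    by_cases hz : rowWeight L (hlCols q u A B) ε ρ t = 0
    · rw [hz]; ring
    · have := sum_add_eq_of_rowWeight_ne_zero (conserves_hlCols _ _ _ _) hz
      rw [qHahnRow_eq (a := ∑ j, ρ j + ε - ∑ j, μ j) (by omega), fullNorm, this]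
      ring
  · refine finsum_eq_zero_of_forall_eq_zero fun t => by_contra fun ht => h ?_
    have := sum_add_eq_of_rowWeight_ne_zero (conserves_hlCols _ _ _ _)
      (right_ne_zero_of_mul (left_ne_zero_of_mul ht))
    have := sum_le_of_qHahnRow_ne_zero (right_ne_zero_of_mul ht)
    omega

theorem finsum_right_eq (q u κ : ℂ) {L : ℕ} {A B : ℕ → ℂ} (hA : A 1 ≠ 0) (hB : B 0 ≠ 0)
    (ρ μ : Fin L → ℕ) (ε : ℕ) :
    ∑ᶠ t, fullNorm q L A B ρ * (fullNorm q L (shift A) B μ / fullNorm q L (shift A) B t) *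
        rowWeight L (hlCols q u (shift A) B) ε t μ * qHahnRow q κ L A B t ρ =
      if ∑ j, μ j ≤ ∑ j, ρ j + ε then ((A 0 * B 0) ^ (∑ j, ρ j))⁻¹ * ((A 1 * B 0) ^ ε)⁻¹ *
        leftWeight q κ A B (∑ j, ρ j + ε - ∑ j, μ j) *
        rightSum q u κ L A B ρ μ ε (∑ j, ρ j + ε - ∑ j, μ j) else 0 := by
  split_ifs with h
  · rw [rightSum, mul_finsum]
    refine finsum_congr fun t => ?_
    by_cases hz : rowWeight L (hlCols q u (shift A) B) ε t μ = 0
    · rw [hz]; ring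
    · have := sum_add_eq_of_rowWeight_ne_zero (conserves_hlCols _ _ _ _) hz
      rw [qHahnRow_eq (a := ∑ j, ρ j + ε - ∑ j, μ j) (by omega), fullNorm, fullNorm, fullNorm,
        ← this, pow_add]
      have h1 : shift A 0 = A 1 := rfl
      have h2 := pow_ne_zero (∑ j, t j) (mul_ne_zero hA hB)
      have h3 := pow_ne_zero ε (mul_ne_zero hA hB)
      rw [h1]
      generalize (A 1 * B 0) ^ (∑ j, t j) = x at *
      generalize (A 1 * B 0) ^ ε = y at *
      simp only [div_eq_mul_inv, mul_inv, inv_inv]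
      field_simp
  · refine finsum_eq_zero_of_forall_eq_zero fun t => by_contra fun ht => h ?_
    have := sum_add_eq_of_rowWeight_ne_zero (conserves_hlCols _ _ _ _)
      (right_ne_zero_of_mul (left_ne_zero_of_mul ht))
    have := sum_le_of_qHahnRow_ne_zero (right_ne_zero_of_mul ht)
    omega

/-- The boundary weights are chosen for this recursion: its two sides are the q-dependent factors in
the off-diagonal entries of the cross. -/
theorem leftWeight_succ {q κ : ℂ} (hq : ∀ r : ℕ, 1 ≤ r → q ^ r ≠ 1) (hκ : κ ≠ 0) (A B : ℕ → ℂ)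
    (D : ℕ) : leftWeight q κ A B (D + 1) * (1 - q ^ (D + 1)) =
      leftWeight q κ A B D * (B 0 * (κ - A 1 * q ^ D)) := by
  have f3 : 1 - q ^ (D + 1) ≠ 0 := sub_ne_zero.2 (hq _ (by omega)).symm
  have g3 := qPoch_self_ne_zero hq D
  simp only [leftWeight, qPoch_succ, ← pow_succ', pow_succ (κ * B 0)]
  generalize hx : A 1 / κ = x
  obtain hx : A 1 = x * κ := by rw [← hx]; field_simp
  rw [hx]
  generalize (κ * B 0) ^ D = y
  field_simp

/-- The exchange relation for one-row operators. -/
theorem row_exchange {q u κ : ℂ} (hq : ∀ r : ℕ, 1 ≤ r → q ^ r ≠ 1) (hκ : κ ≠ 0) {L : ℕ}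
    {A B : ℕ → ℂ} (hA : ∀ j, A j ≠ 0) (hB : ∀ j, B j ≠ 0)
    (hσ : ∀ j r : ℕ, A (j + 1) * B (j + 1) * q ^ r ≠ 1)
    (hσ' : ∀ j r : ℕ, A (j + 2) * B (j + 1) * q ^ r ≠ 1) (hu : ∀ j, u * A (j + 1) ≠ 1)
    (ρ μ : Fin (L + 1) → ℕ) (hμ : μ (Fin.last L) = 0) :
    ∑ᶠ t, fullNorm q (L + 1) A B t * hlRow q u (L + 1) A B ρ t * qHahnRow q κ (L + 1) A B μ t =
      (1 - u * κ) / (1 - u * A 1) *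
        ∑ᶠ t, fullNorm q (L + 1) A B ρ *
          (fullNorm q (L + 1) (shift A) B μ / fullNorm q (L + 1) (shift A) B t) *
          hlRow q u (L + 1) (shift A) B t μ * qHahnRow q κ (L + 1) A B t ρ := by
  obtain ⟨h₀, h₁⟩ := exchange hq hκ hA hB hσ hσ' hu ρ μ hμ
  have e : 1 - u * A 1 ≠ 0 := sub_ne_zero.2 (hu 0).symm
  have hA0 := hA 0
  have hA1 := hA 1
  have hB0 := hB 0
  have l : ∑ᶠ t, fullNorm q (L + 1) A B t * hlRow q u (L + 1) A B ρ t *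
      qHahnRow q κ (L + 1) A B μ t =
      ∑ ε : Fin 2, (-(u * A 0)) ^ (ε : ℕ) * ∑ᶠ t, fullNorm q (L + 1) A B t *
        rowWeight (L + 1) (hlCols q u A B) ε ρ t * qHahnRow q κ (L + 1) A B μ t := by
    simp_rw [mul_finsum]
    rw [← finsum_sum_comm]
    · refine finsum_congr fun t => ?_
      rw [hlRow, Finset.mul_sum, Finset.sum_mul]
      exact Finset.sum_congr rfl fun _ _ => by ring
    · intro ε _
      refine (finite_sum_le _ (∑ j, ρ j + ε)).subset fun t ht => ?_
      exact (sum_add_eq_of_rowWeight_ne_zero (conserves_hlCols _ _ _ _)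
        (right_ne_zero_of_mul (left_ne_zero_of_mul (right_ne_zero_of_mul ht)))).ge
  have r : ∑ᶠ t, fullNorm q (L + 1) A B ρ *
          (fullNorm q (L + 1) (shift A) B μ / fullNorm q (L + 1) (shift A) B t) *
          hlRow q u (L + 1) (shift A) B t μ * qHahnRow q κ (L + 1) A B t ρ =
      ∑ ε : Fin 2, (-(u * A 1)) ^ (ε : ℕ) * ∑ᶠ t, fullNorm q (L + 1) A B ρ *
          (fullNorm q (L + 1) (shift A) B μ / fullNorm q (L + 1) (shift A) B t) *
        rowWeight (L + 1) (hlCols q u (shift A) B) ε t μ * qHahnRow q κ (L + 1) A B t ρ := by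
    simp_rw [mul_finsum]
    rw [← finsum_sum_comm]
    · refine finsum_congr fun t => ?_
      rw [hlRow, Finset.mul_sum, Finset.sum_mul]
      exact Finset.sum_congr rfl fun _ _ => by rw [show shift A 0 = A 1 from rfl]; ring
    · intro ε _
      refine (finite_sum_le _ (∑ j, μ j)).subset fun t ht => ?_
      have := sum_add_eq_of_rowWeight_ne_zero (conserves_hlCols _ _ _ _)
        (right_ne_zero_of_mul (left_ne_zero_of_mul (right_ne_zero_of_mul ht)))
      simp only [Set.mem_ofPred_eq]
      omega
  rw [l, r, Fin.sum_univ_two, Fin.sum_univ_two]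
  simp only [finsum_left_eq, finsum_right_eq q u κ hA1 hB0, Fin.val_zero, Fin.val_one, add_zero]
  -- The left label of the W-row is Σρ + ε - Σμ. Neither, only ε = 1 (with label 0), or both values
  -- of ε contribute.
  rcases lt_trichotomy (∑ j, ρ j + 1) (∑ j, μ j) with h | h | h
  · rw [if_neg (by omega), if_neg (by omega), if_neg (by omega), if_neg (by omega)]
    ring
  · have hn : ¬ ∑ j, μ j ≤ ∑ j, ρ j := by omega
    have hp : ∑ j, μ j ≤ ∑ j, ρ j + 1 := by omega
    simp only [if_neg hn, if_pos hp, show ∑ j, ρ j + 1 - ∑ j, μ j = 0 by omega]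
    have h1 := h₁ 0
    rw [pow_zero, sub_self, zero_mul, zero_add, mul_comm, ← eq_div_iff e] at h1
    rw [h1, pow_succ (A 0 * B 0)]
    simp only [pow_zero, pow_one]
    have := pow_ne_zero (∑ j, ρ j) (mul_ne_zero hA0 hB0)
    generalize (A 0 * B 0) ^ (∑ j, ρ j) = x at *
    field_simp
    ring
  · obtain ⟨D, hD⟩ := Nat.exists_eq_add_of_le (Nat.lt_succ_iff.1 h)
    have hn : ∑ j, μ j ≤ ∑ j, ρ j := by omega
    have hp : ∑ j, μ j ≤ ∑ j, ρ j + 1 := by omega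
    simp only [if_pos hn, if_pos hp, show ∑ j, ρ j + 1 - ∑ j, μ j = D + 1 by omega,
      show ∑ j, ρ j - ∑ j, μ j = D by omega]
    have d := leftWeight_succ hq hκ A B D
    have f3 : 1 - q ^ (D + 1) ≠ 0 := sub_ne_zero.2 (hq _ (by omega)).symm
    rw [← eq_div_iff f3] at d
    have h0 := h₀ D
    have h1 := h₁ (D + 1)
    rw [mul_comm, ← eq_div_iff e] at h0 h1
    -- After the recursion for the boundary weights, the coefficient of r₀(D) contains (1 - uA_1q^D)
    -- - u(κ - A_1q^D) and that of r₁(D+1) contains (1 - q^{D+1}) + (q^{D+1} - uκ). Both equal 1 -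
    -- uκ.
    rw [h0, h1, d, Nat.add_sub_cancel, pow_succ (A 0 * B 0)]
    simp only [pow_zero, pow_one]
    have := pow_ne_zero (∑ j, ρ j) (mul_ne_zero hA0 hB0)
    generalize (A 0 * B 0) ^ (∑ j, ρ j) = x at *
    generalize leftWeight q κ A B D = y
    generalize q ^ (D + 1) = z at *
    field_simp
    ring

/-! ### The dual Cauchy identity for iterated one-row operators -/

/-- The iterated `w`-rows applied to the empty partition. -/
def hlSum (q : ℂ) (L : ℕ) (A B : ℕ → ℂ) : (m : ℕ) → (Fin m → ℂ) → (Fin L → ℕ) → ℂ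
  | 0, _, t => if t = 0 then 1 else 0
  | m + 1, u, t => ∑ᶠ ρ, hlRow q (u 0) L A B ρ t * hlSum q L A B m (Fin.tail u) ρ

/-- The iterated `W`-rows applied to the empty partition. -/
def qHahnSum (q : ℂ) (L : ℕ) (B : ℕ → ℂ) : (n : ℕ) → (Fin n → ℂ) → (ℕ → ℂ) → (Fin L → ℕ) → ℂ
  | 0, _, _, t => if t = 0 then 1 else 0
  | n + 1, κ, A, t =>
    ∑ᶠ μ, qHahnRow q (κ 0) L A B μ t * qHahnSum q L B n (Fin.tail κ) (shift A) μ

theorem labelNorm_zero (q σ : ℂ) : labelNorm q σ 0 = 1 := by simp [labelNorm, qPoch_zero]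

theorem partitionNorm_zero (q : ℂ) (L : ℕ) (A B : ℕ → ℂ) :
    partitionNorm q L A B (fun _ => 0) = 1 := by
  induction L generalizing A B with
  | zero => rfl
  | succ L ih =>
    rw [partitionNorm, labelNorm_zero,
      show Fin.tail (fun _ : Fin (L + 1) => 0) = fun _ : Fin L => 0 from rfl, ih]
    simp

theorem fullNorm_zero (q : ℂ) (L : ℕ) (A B : ℕ → ℂ) : fullNorm q L A B 0 = 1 := by
  rw [fullNorm, show (0 : Fin L → ℕ) = fun _ => 0 from rfl, partitionNorm_zero]
  simp

theorem partitionNorm_ne_zero {q : ℂ} (hq : ∀ r : ℕ, 1 ≤ r → q ^ r ≠ 1) {L : ℕ} {A B : ℕ → ℂ}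
    (hA : ∀ j, A j ≠ 0) (hB : ∀ j, B j ≠ 0)
    (hσ : ∀ j r : ℕ, A (j + 1) * B (j + 1) * q ^ r ≠ 1) (t : Fin L → ℕ) :
    partitionNorm q L A B t ≠ 0 := by
  induction L generalizing A B with
  | zero => exact one_ne_zero
  | succ L ih =>
    exact mul_ne_zero (mul_ne_zero (labelNorm_ne_zero hq (hσ 0) _)
      (inv_ne_zero (pow_ne_zero _ (mul_ne_zero (hA 1) (hB 1)))))
      (ih (A := shift A) (B := shift B) (fun j => hA _) (fun j => hB _) (fun j => hσ _) _)

theorem fullNorm_ne_zero {q : ℂ} (hq : ∀ r : ℕ, 1 ≤ r → q ^ r ≠ 1) {L : ℕ} {A B : ℕ → ℂ}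
    (hA : ∀ j, A j ≠ 0) (hB : ∀ j, B j ≠ 0)
    (hσ : ∀ j r : ℕ, A (j + 1) * B (j + 1) * q ^ r ≠ 1) (t : Fin L → ℕ) :
    fullNorm q L A B t ≠ 0 :=
  mul_ne_zero (inv_ne_zero (pow_ne_zero _ (mul_ne_zero (hA 0) (hB 0))))
    (partitionNorm_ne_zero hq hA hB hσ t)

theorem rowWeight_zero {L : ℕ} {wt : ℕ → ℕ → ℕ → ℕ → ℕ → ℂ} (hwt : ∀ c, wt c 0 0 0 0 = 1) :
    rowWeight L wt 0 (fun _ => 0) (fun _ => 0) = 1 := by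
  induction L generalizing wt with
  | zero => rfl
  | succ L ih =>
    rw [rowWeight, show Fin.tail (fun _ : Fin (L + 1) => 0) = fun _ : Fin L => 0 from rfl]
    simp only [Nat.add_zero, Nat.sub_self, hwt, one_mul]
    exact ih fun c => hwt (c + 1)

/-- Nothing leaves the last column on the right, so its top label is its bottom label plus what
enters. An empty last column therefore stays empty when read downwards. -/
theorem bot_last_le_of_rowWeight_ne_zero {L : ℕ} {wt : ℕ → ℕ → ℕ → ℕ → ℕ → ℂ}
    (hwt : Conserves wt) {a : ℕ} {bot top : Fin (L + 1) → ℕ}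
    (h : rowWeight (L + 1) wt a bot top ≠ 0) : bot (Fin.last L) ≤ top (Fin.last L) := by
  induction L generalizing wt a with
  | zero =>
    have := sum_add_eq_of_rowWeight_ne_zero hwt h
    rw [Fin.sum_univ_castSucc, Fin.sum_univ_castSucc] at this
    simp at this
    exact le_of_add_le_left this.le
  | succ L ih =>
    rw [rowWeight] at h
    exact ih hwt.succ (right_ne_zero_of_mul h)

/-- A vertex that emits at most its bottom label passes nothing on from an empty column, so one row
enlarges the support by at most one column. -/
theorem top_eq_zero_of_rowWeight_ne_zero {L : ℕ} {wt : ℕ → ℕ → ℕ → ℕ → ℕ → ℂ}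
    (hwt : Conserves wt) (hle : ∀ c i j k l, wt c i j k l ≠ 0 → l ≤ i) {a n : ℕ}
    {bot top : Fin L → ℕ} (h : rowWeight L wt a bot top ≠ 0)
    (hbot : ∀ j : Fin L, n ≤ j → bot j = 0) (j : Fin L) (hj : n + 1 ≤ j) : top j = 0 := by
  induction L generalizing wt a n with
  | zero => exact j.elim0
  | succ L ih =>
    rw [rowWeight] at h
    obtain ⟨j, rfl⟩ := Fin.exists_succ_eq.2 (show j ≠ 0 by rintro rfl; simp at hj)
    rw [Fin.val_succ] at hj
    rcases n with _ | n
    · have h1 := hle _ _ _ _ _ (left_ne_zero_of_mul h)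
      have h2 := sum_add_eq_of_rowWeight_ne_zero hwt.succ (right_ne_zero_of_mul h)
      have h3 : ∑ j, Fin.tail bot j = 0 := Finset.sum_eq_zero fun j _ => hbot _ (Nat.zero_le _)
      have h4 : bot 0 = 0 := hbot 0 (Nat.zero_le _)
      have h5 : ∑ j, Fin.tail top j = 0 := by omega
      exact Finset.sum_eq_zero_iff.1 h5 j (Finset.mem_univ _)
    · exact ih hwt.succ (fun c => hle (c + 1)) (right_ne_zero_of_mul h)
        (n := n) (fun i hi => hbot i.succ (by rw [Fin.val_succ]; omega)) j (by omega)

theorem eq_zero_of_sum_le {L : ℕ} {t : Fin L → ℕ} (h : ∑ j, t j ≤ 0) : t = 0 :=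
  funext fun j => Finset.sum_eq_zero_iff.1 (Nat.le_zero.1 h) j (Finset.mem_univ _)

theorem exists_apply_ne_zero_of_finsum_ne_zero {α : Type*} {f : α → ℂ} (h : ∑ᶠ a, f a ≠ 0) :
    ∃ a, f a ≠ 0 := by
  by_contra! h'
  exact h (finsum_eq_zero_of_forall_eq_zero h')

theorem sum_le_of_hlSum_ne_zero {q : ℂ} {L : ℕ} {A B : ℕ → ℂ} {m : ℕ} {u : Fin m → ℂ}
    {t : Fin L → ℕ} (h : hlSum q L A B m u t ≠ 0) : ∑ j, t j ≤ m := by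
  induction m generalizing t with
  | zero =>
    rw [hlSum] at h
    split_ifs at h with h'
    · simp [h']
    · exact absurd rfl h
  | succ m ih =>
    rw [hlSum] at h
    obtain ⟨ρ, hρ⟩ := exists_apply_ne_zero_of_finsum_ne_zero h
    have h1 := sum_le_of_hlRow_ne_zero (left_ne_zero_of_mul hρ)
    have h2 := ih (right_ne_zero_of_mul hρ)
    omega

theorem eq_zero_of_qHahnSum_ne_zero {q : ℂ} {L : ℕ} {A B : ℕ → ℂ} {n : ℕ} {κ : Fin n → ℂ}
    {t : Fin L → ℕ} (h : qHahnSum q L B n κ A t ≠ 0) (j : Fin L) (hj : n ≤ j) : t j = 0 := by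
  induction n generalizing t A j with
  | zero =>
    rw [qHahnSum] at h
    split_ifs at h with h'
    · simp [h']
    · exact absurd rfl h
  | succ n ih =>
    rw [qHahnSum] at h
    obtain ⟨μ, hμ⟩ := exists_apply_ne_zero_of_finsum_ne_zero h
    obtain ⟨a, ha⟩ := exists_apply_ne_zero_of_finsum_ne_zero (left_ne_zero_of_mul hμ)
    exact top_eq_zero_of_rowWeight_ne_zero (conserves_qHahnCols _ _ _ _)
      (fun _ _ _ _ _ h => (qHahnWeight_conserve h).2) (right_ne_zero_of_mul ha)
      (n := n) (fun j hj => ih (right_ne_zero_of_mul hμ) j hj) j hj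

theorem hlRow_zero_zero {q u : ℂ} {L : ℕ} {A B : ℕ → ℂ} (hu : ∀ j, u * A (j + 1) ≠ 1) :
    hlRow q u L A B 0 0 = 1 := by
  rw [hlRow, Fin.sum_univ_two, Fin.val_zero, Fin.val_one, pow_zero, one_mul,
    show (0 : Fin L → ℕ) = fun _ => 0 from rfl, rowWeight_zero (wt := hlCols q u A B) fun c => hlWeight_zero _ _ _ (hu c)]
  have : rowWeight L (hlCols q u A B) 1 (fun _ => 0) (fun _ => 0) = 0 := by
    by_contra h
    have := sum_add_eq_of_rowWeight_ne_zero (conserves_hlCols _ _ _ _) h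
    omega
  rw [this]
  ring

theorem qHahnRow_zero_zero (q κ : ℂ) (L : ℕ) (A B : ℕ → ℂ) : qHahnRow q κ L A B 0 0 = 1 := by
  rw [qHahnRow_eq (a := 0) (by simp), show (0 : Fin L → ℕ) = fun _ => 0 from rfl,
    rowWeight_zero (wt := qHahnCols q κ A B) fun c => qHahnWeight_zero _ _ _]
  simp [leftWeight, qPoch_zero]

theorem hlSum_zero {q : ℂ} {L : ℕ} {A B : ℕ → ℂ} {m : ℕ} {u : Fin m → ℂ}
    (hu : ∀ i j, u i * A (j + 1) ≠ 1) : hlSum q L A B m u 0 = 1 := by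
  induction m with
  | zero => simp [hlSum]
  | succ m ih =>
    rw [hlSum, finsum_eq_single _ 0, hlRow_zero_zero (hu 0), one_mul]
    · exact ih fun i => hu i.succ
    · intro ρ hρ
      by_contra h
      have := (sum_le_of_hlRow_ne_zero (left_ne_zero_of_mul h)).1
      exact hρ (eq_zero_of_sum_le (by simpa using this))

/-- The W-row is exchanged with the w-rows one at a time, each contributing its factor. At the end
it meets the empty partition, where it acts trivially. -/
theorem hlSum_qHahnRow {q κ : ℂ} (hq : ∀ r : ℕ, 1 ≤ r → q ^ r ≠ 1) (hκ : κ ≠ 0) {L : ℕ}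
    {A B : ℕ → ℂ} (hA : ∀ j, A j ≠ 0) (hB : ∀ j, B j ≠ 0)
    (hσ : ∀ j r : ℕ, A (j + 1) * B (j + 1) * q ^ r ≠ 1)
    (hσ' : ∀ j r : ℕ, A (j + 2) * B (j + 1) * q ^ r ≠ 1) {m : ℕ} {u : Fin m → ℂ}
    (hu : ∀ i j, u i * A (j + 1) ≠ 1) (μ : Fin (L + 1) → ℕ) (hμ : μ (Fin.last L) = 0) :
    ∑ᶠ t, fullNorm q (L + 1) A B t * hlSum q (L + 1) A B m u t * qHahnRow q κ (L + 1) A B μ t =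
      (∏ j, (1 - u j * κ) / (1 - u j * A 1)) *
        (fullNorm q (L + 1) (shift A) B μ * hlSum q (L + 1) (shift A) B m u μ) := by
  induction m generalizing μ with
  | zero =>
    rw [finsum_eq_single _ 0]
    · rw [fullNorm_zero, hlSum, hlSum, if_pos rfl]
      split_ifs with h
      · rw [h, qHahnRow_zero_zero, fullNorm_zero]
        simp
      · have : qHahnRow q κ (L + 1) A B μ 0 = 0 := by
          by_contra h'
          exact h (eq_zero_of_sum_le (by simpa using sum_le_of_qHahnRow_ne_zero h'))
        rw [this]
        simp
    · intro t ht
      rw [hlSum, if_neg ht]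
      simp
  | succ m ih =>
    have ih := fun ν hν => ih (u := Fin.tail u) (fun i => hu i.succ) ν hν
    have e1 : ∀ t, fullNorm q (L + 1) A B t * hlSum q (L + 1) A B (m + 1) u t *
        qHahnRow q κ (L + 1) A B μ t = ∑ᶠ ρ, hlSum q (L + 1) A B m (Fin.tail u) ρ *
          (fullNorm q (L + 1) A B t * hlRow q (u 0) (L + 1) A B ρ t *
            qHahnRow q κ (L + 1) A B μ t) := by
      intro t
      rw [hlSum, mul_finsum, finsum_mul]
      exact finsum_congr fun ρ => by ring
    have e2 : ∀ ρ, hlSum q (L + 1) A B m (Fin.tail u) ρ * ((1 - u 0 * κ) / (1 - u 0 * A 1) *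
        ∑ᶠ ν, fullNorm q (L + 1) A B ρ *
          (fullNorm q (L + 1) (shift A) B μ / fullNorm q (L + 1) (shift A) B ν) *
          hlRow q (u 0) (L + 1) (shift A) B ν μ * qHahnRow q κ (L + 1) A B ν ρ) =
        ∑ᶠ ν, (1 - u 0 * κ) / (1 - u 0 * A 1) *
          (fullNorm q (L + 1) (shift A) B μ / fullNorm q (L + 1) (shift A) B ν) *
          hlRow q (u 0) (L + 1) (shift A) B ν μ *
          (fullNorm q (L + 1) A B ρ * hlSum q (L + 1) A B m (Fin.tail u) ρ *
            qHahnRow q κ (L + 1) A B ν ρ) := by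
      intro ρ
      rw [mul_finsum, mul_finsum]
      exact finsum_congr fun ν => by ring
    simp_rw [e1]
    rw [finsum_comm_of_finite]
    swap
    · refine ((finite_sum_le (L + 1) (m + 1)).prod (finite_sum_le (L + 1) m)).subset
        fun p hp => ?_
      have h1 := sum_le_of_hlSum_ne_zero (left_ne_zero_of_mul hp)
      have h2 := sum_le_of_hlRow_ne_zero (right_ne_zero_of_mul (left_ne_zero_of_mul
        (right_ne_zero_of_mul hp)))
      exact ⟨by simp only [Set.mem_ofPred_eq]; omega, h1⟩
    simp_rw [← mul_finsum, row_exchange hq hκ hA hB hσ hσ' (hu 0) _ μ hμ, e2]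
    rw [finsum_comm_of_finite]
    swap
    · refine ((finite_sum_le (L + 1) m).prod (finite_sum_le (L + 1) (∑ j, μ j))).subset
        fun p hp => ?_
      have h1 := sum_le_of_hlSum_ne_zero (right_ne_zero_of_mul (left_ne_zero_of_mul
        (right_ne_zero_of_mul hp)))
      have h2 := sum_le_of_hlRow_ne_zero (right_ne_zero_of_mul (left_ne_zero_of_mul hp))
      exact ⟨h1, h2.1⟩
    simp_rw [← mul_finsum]
    rw [hlSum, mul_finsum, mul_finsum]
    refine finsum_congr fun ν => ?_
    by_cases hz : hlRow q (u 0) (L + 1) (shift A) B ν μ = 0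
    · rw [hz]; ring
    -- The exchange relation needs an empty last column, and this is inherited by ν because ν lies
    -- below μ in a w-row.
    · have hν : ν (Fin.last L) = 0 := by
        obtain ⟨ε, -, hε⟩ := Finset.exists_ne_zero_of_sum_ne_zero hz
        have := bot_last_le_of_rowWeight_ne_zero (conserves_hlCols _ _ _ _)
          (right_ne_zero_of_mul hε)
        omega
      rw [ih ν hν, Fin.prod_univ_succ]
      have := fullNorm_ne_zero hq (A := shift A) (fun j => hA _) hB hσ' ν
      simp only [Fin.tail]
      generalize fullNorm q (L + 1) (shift A) B ν = x at *
      generalize hlSum q (L + 1) (shift A) B m (fun i => u i.succ) ν = y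
      field_simp

/-- The dual Cauchy identity for iterated one-row operators. -/
theorem dualCauchy_rows {q : ℂ} (hq : ∀ r : ℕ, 1 ≤ r → q ^ r ≠ 1) {L : ℕ} {A B : ℕ → ℂ}
    {n m : ℕ} (hn : n ≤ L) {κ : Fin n → ℂ} (hκ : ∀ i, κ i ≠ 0)
    (hA : ∀ j, A j ≠ 0) (hB : ∀ j, B j ≠ 0)
    (hσ : ∀ i j r : ℕ, i ≤ n → A (i + j + 1) * B (j + 1) * q ^ r ≠ 1) {u : Fin m → ℂ}
    (hu : ∀ i j, u i * A (j + 1) ≠ 1) :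
    ∑ᶠ t, fullNorm q (L + 1) A B t * hlSum q (L + 1) A B m u t * qHahnSum q (L + 1) B n κ A t =
      ∏ i : Fin n, ∏ j, (1 - u j * κ i) / (1 - u j * A (i + 1)) := by
  induction n generalizing A with
  | zero =>
    rw [finsum_eq_single _ 0]
    · rw [fullNorm_zero, hlSum_zero hu, qHahnSum]
      simp
    · intro t ht
      rw [qHahnSum, if_neg ht]
      simp
  | succ n ih =>
    have ih := ih (by omega) (κ := Fin.tail κ) (fun i => hκ i.succ) (A := shift A) (fun j => hA _)
      (fun i j r hi => by
        have := hσ (i + 1) j r (by omega)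
        rwa [show i + 1 + j + 1 = i + j + 1 + 1 by omega] at this)
      (fun i j => hu i _)
    have e1 : ∀ t, fullNorm q (L + 1) A B t * hlSum q (L + 1) A B m u t *
        qHahnSum q (L + 1) B (n + 1) κ A t =
        ∑ᶠ μ, qHahnSum q (L + 1) B n (Fin.tail κ) (shift A) μ *
          (fullNorm q (L + 1) A B t * hlSum q (L + 1) A B m u t *
            qHahnRow q (κ 0) (L + 1) A B μ t) := by
      intro t
      rw [qHahnSum, mul_finsum]
      exact finsum_congr fun μ => by ring
    simp_rw [e1]
    rw [finsum_comm_of_finite]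
    swap
    · refine ((finite_sum_le (L + 1) m).prod (finite_sum_le (L + 1) m)).subset
        fun p hp => ?_
      have h1 := sum_le_of_hlSum_ne_zero (right_ne_zero_of_mul (left_ne_zero_of_mul
        (right_ne_zero_of_mul hp)))
      have h2 := sum_le_of_qHahnRow_ne_zero (right_ne_zero_of_mul (right_ne_zero_of_mul hp))
      exact ⟨h1, h2.trans h1⟩
    rw [Fin.prod_univ_succ, show (∏ i : Fin n, ∏ j, (1 - u j * κ i.succ) /
      (1 - u j * A (i.succ + 1))) = _ from ih.symm, mul_finsum]
    refine finsum_congr fun μ => ?_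
    rw [← mul_finsum]
    by_cases hz : qHahnSum q (L + 1) B n (Fin.tail κ) (shift A) μ = 0
    · rw [hz]; ring
    -- The remaining W-rows reach too few columns to occupy the last one; this is where n ≤ L
    -- enters.
    · rw [hlSum_qHahnRow hq (hκ 0) hA hB
        (fun j r => by simpa using hσ 0 j r (by omega))
        (fun j r => by
          have := hσ 1 j r (by omega)
          rwa [show 1 + j + 1 = j + 2 by omega] at this) hu μ
        (eq_zero_of_qHahnSum_ne_zero hz (Fin.last L) (by rw [Fin.val_last]; omega))]
      rw [Fin.val_zero, zero_add]
      ring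

/-! ### Grids of vertices as iterated rows -/

theorem finsum_mem_eq_finsum_of_support {α : Type*} (s : Set α) (f : α → ℂ)
    (h : ∀ a, f a ≠ 0 → a ∈ s) : ∑ᶠ a ∈ s, f a = ∑ᶠ a, f a := by
  rw [← finsum_mem_univ f]
  exact finsum_mem_inter_support_eq' f s Set.univ fun x hx => iff_of_true (h x hx) trivial

/-- Once the vertical edges are fixed, conservation leaves at most one contributing labelling of the
horizontal edges. -/
theorem finsum_horizontal {L : ℕ} {wt : ℕ → ℕ → ℕ → ℕ → ℕ → ℂ} (hwt : Conserves wt) (a : ℕ)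
    (bot top : Fin L → ℕ) :
    ∑ᶠ y ∈ {y : Fin (L + 1) → ℕ | y 0 = a ∧ y (Fin.last L) = 0},
      ∏ j : Fin L, wt j (bot j) (y j.castSucc) (top j) (y j.succ) = rowWeight L wt a bot top := by
  induction L generalizing wt a with
  | zero =>
    simp only [Finset.univ_eq_empty, Finset.prod_empty]
    rw [rowWeight]
    split_ifs with h
    · rw [show {y : Fin (0 + 1) → ℕ | y 0 = a ∧ y (Fin.last 0) = 0} = {fun _ => 0} from ?_,
        finsum_mem_singleton]
      ext y
      simp only [Set.mem_ofPred_eq, Set.mem_singleton_iff]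
      constructor
      · rintro ⟨h1, h2⟩
        funext i
        rwa [Fin.eq_zero i, ← Fin.last_zero]
      · rintro rfl
        exact ⟨h.symm, rfl⟩
    · rw [show {y : Fin (0 + 1) → ℕ | y 0 = a ∧ y (Fin.last 0) = 0} = ∅ from ?_,
        finsum_mem_empty]
      ext y
      simp only [Set.mem_ofPred_eq, Set.mem_empty_iff_false, iff_false, not_and]
      rintro h1 h2
      exact h (h1.symm.trans h2)
  | succ L ih =>
    rw [rowWeight, ← ih hwt.succ, mul_finsum_mem]
    symm
    rw [← finsum_mem_inter_support_eq' _ {y : Fin (L + 2) → ℕ | y 0 = a ∧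
      y 1 = bot 0 + a - top 0 ∧ y (Fin.last (L + 1)) = 0}]
    · refine finsum_mem_eq_of_bijOn (fun y => Fin.cons a y) ⟨?_, ?_, ?_⟩ ?_
      · rintro y ⟨h1, h2⟩
        exact ⟨rfl, h1, h2⟩
      · intro y _ y' _ h
        exact (Fin.cons_injective2 h).2
      · rintro y ⟨h1, h2, h3⟩
        refine ⟨Fin.tail y, ⟨h2, h3⟩, ?_⟩
        rw [← h1]
        exact Fin.cons_self_tail y
      · rintro y ⟨h1, h2⟩
        rw [Fin.prod_univ_succ]
        congr 1
        simp only [Fin.castSucc_zero, Fin.cons_zero, Fin.cons_succ, h1]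
        rfl
    · intro y hy
      have h := Finset.prod_ne_zero_iff.1 hy 0 (Finset.mem_univ _)
      have h := hwt _ _ _ _ _ h
      rw [Fin.castSucc_zero, show Fin.succ (0 : Fin (L + 1)) = 1 from rfl] at h
      constructor
      · rintro ⟨h1, -, h3⟩
        exact ⟨h1, h3⟩
      · rintro ⟨h1, h3⟩
        exact ⟨h1, by omega, h3⟩

theorem horizontal_bound {L : ℕ} {bot top : Fin L → ℕ} {y : Fin (L + 1) → ℕ}
    (h : ∀ j : Fin L, bot j + y j.castSucc = top j + y j.succ) (hy : y (Fin.last L) = 0) :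
    ∑ j, bot j + y 0 = ∑ j, top j ∧ ∀ j, y j ≤ ∑ j, top j := by
  induction L with
  | zero =>
    refine ⟨by simpa using hy, fun j => ?_⟩
    rw [Fin.eq_zero j]
    exact (show y 0 = 0 from hy).le.trans (Nat.zero_le _)
  | succ L ih =>
    obtain ⟨h1, h2⟩ := ih (bot := Fin.tail bot) (top := Fin.tail top) (y := Fin.tail y)
      (fun j => h j.succ) hy
    have h0 := h 0
    simp only [Fin.tail] at h1 h2
    rw [Fin.castSucc_zero] at h0
    rw [Fin.sum_univ_succ, Fin.sum_univ_succ]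
    refine ⟨by omega, fun j => ?_⟩
    rcases Fin.eq_zero_or_eq_succ j with rfl | ⟨j, rfl⟩
    · omega
    · exact (h2 j).trans (Nat.le_add_left _ _)

/-- Edge labellings with all labels at most `K`. -/
def labelBox (n L K : ℕ) : Set ((Fin (n + 1) → Fin L → ℕ) × (Fin n → Fin (L + 1) → ℕ)) :=
  {c | (∀ i j, c.1 i j ≤ K) ∧ ∀ i j, c.2 i j ≤ K}

theorem finite_labelBox (n L K : ℕ) : (labelBox n L K).Finite :=
  ((Set.finite_Iic fun (_ : Fin (n + 1)) (_ : Fin L) => K).prod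
    (Set.finite_Iic fun (_ : Fin n) (_ : Fin (L + 1)) => K)).subset fun _ hc => ⟨hc.1, hc.2⟩

/-- The product of all vertex weights of a labelled grid. -/
def gridWeight {n L : ℕ} (W : Fin n → ℕ → ℕ → ℕ → ℕ → ℕ → ℂ)
    (c : (Fin (n + 1) → Fin L → ℕ) × (Fin n → Fin (L + 1) → ℕ)) : ℂ :=
  ∏ i : Fin n, ∏ j : Fin L,
    W i j (c.1 i.succ j) (c.2 i j.castSucc) (c.1 i.castSucc j) (c.2 i j.succ)

/-- The total of the vertical labels cannot increase downwards, and each horizontal label is bounded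
by the total above its row. So only finitely many labellings contribute. -/
theorem mem_labelBox {n L : ℕ} {W : Fin n → ℕ → ℕ → ℕ → ℕ → ℕ → ℂ} (hW : ∀ i, Conserves (W i))
    {left : Fin n → ℕ} {bottom top : Fin L → ℕ}
    {c : (Fin (n + 1) → Fin L → ℕ) × (Fin n → Fin (L + 1) → ℕ)}
    (hc : c ∈ gridConfigs n L left bottom top) (h : gridWeight W c ≠ 0) :
    c ∈ labelBox n L (∑ j, top j) := by
  obtain ⟨h1, h2, h3, h4⟩ := hc
  have key := fun i : Fin n => horizontal_bound (bot := c.1 i.succ) (top := c.1 i.castSucc)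
    (y := c.2 i) (fun j => hW i _ _ _ _ _ (Finset.prod_ne_zero_iff.1
      (Finset.prod_ne_zero_iff.1 h i (Finset.mem_univ _)) j (Finset.mem_univ _))) (h4 i)
  have hv : ∀ i, ∑ j, c.1 i j ≤ ∑ j, top j := by
    intro i
    induction i using Fin.induction with
    | zero => rw [h1]
    | succ i ih => exact le_trans (by have := (key i).1; omega) ih
  exact ⟨fun i j => (Finset.single_le_sum (f := c.1 i) (fun _ _ => Nat.zero_le _)
    (Finset.mem_univ j)).trans (hv i), fun i j => ((key i).2 j).trans (hv i.castSucc)⟩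

theorem gridPartition_zero {L : ℕ} (W : Fin 0 → ℕ → ℕ → ℕ → ℕ → ℕ → ℂ) (left : Fin 0 → ℕ)
    (bottom top : Fin L → ℕ) :
    gridPartition 0 L (fun i j => W i j) left bottom top = if top = bottom then 1 else 0 := by
  simp only [gridPartition, Finset.univ_eq_empty, Finset.prod_empty]
  split_ifs with h
  · rw [show gridConfigs 0 L left bottom top = {(fun _ => top, fun i => i.elim0)} from ?_,
      finsum_mem_singleton]
    ext c
    simp only [gridConfigs, Set.mem_ofPred_eq, Set.mem_singleton_iff]
    constructor
    · rintro ⟨h1, -⟩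
      refine Prod.ext (funext fun i => ?_) (funext fun i => i.elim0)
      rw [Fin.eq_zero i]
      exact h1
    · rintro rfl
      exact ⟨rfl, h, fun i => i.elim0, fun i => i.elim0⟩
  · rw [show gridConfigs 0 L left bottom top = ∅ from ?_, finsum_mem_empty]
    ext c
    simp only [gridConfigs, Set.mem_ofPred_eq, Set.mem_empty_iff_false, iff_false]
    rintro ⟨h1, h2, -⟩
    exact h (h1.symm.trans h2)

/-- Transfer-matrix decomposition: cut the grid along the vertical edges μ below its first row. -/
theorem gridPartition_succ {n L : ℕ} {W : Fin (n + 1) → ℕ → ℕ → ℕ → ℕ → ℕ → ℂ}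
    (hW : ∀ i, Conserves (W i)) (left : Fin (n + 1) → ℕ) (bottom top : Fin L → ℕ) :
    gridPartition (n + 1) L (fun i j => W i j) left bottom top =
      ∑ᶠ μ, rowWeight L (W 0) (left 0) μ top *
        gridPartition n L (fun i j => W i.succ j) (Fin.tail left) bottom μ := by
  classical
  -- A labelling of the grid is a labelling of the lower rows with free top edges, together with the
  -- horizontal labels of the first row.
  let s : Set (((Fin (n + 1) → Fin L → ℕ) × (Fin n → Fin (L + 1) → ℕ)) × (Fin (L + 1) → ℕ)) :=
    {p | p.1 ∈ gridConfigs n L (Fin.tail left) bottom (p.1.1 0) ∧ p.2 0 = left 0 ∧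
      p.2 (Fin.last L) = 0}
  let e : ((Fin (n + 1) → Fin L → ℕ) × (Fin n → Fin (L + 1) → ℕ)) × (Fin (L + 1) → ℕ) →
      (Fin (n + 2) → Fin L → ℕ) × (Fin (n + 1) → Fin (L + 1) → ℕ) :=
    fun p => (Fin.cons top p.1.1, Fin.cons p.2 p.1.2)
  have he : Function.Injective e := by
    rintro ⟨⟨v, h⟩, y⟩ ⟨⟨v', h'⟩, y'⟩ hp
    have h1 := (Fin.cons_injective2 (show (Fin.cons top v : Fin (n + 2) → Fin L → ℕ) =
      Fin.cons top v' from congrArg Prod.fst hp)).2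
    have h2 := Fin.cons_injective2 (show (Fin.cons y h : Fin (n + 1) → Fin (L + 1) → ℕ) =
      Fin.cons y' h' from congrArg Prod.snd hp)
    rw [h1, h2.1, h2.2]
  let f : ((Fin (n + 1) → Fin L → ℕ) × (Fin n → Fin (L + 1) → ℕ)) × (Fin (L + 1) → ℕ) → ℂ :=
    fun p => (∏ j : Fin L, W 0 j (p.1.1 0 j) (p.2 j.castSucc) (top j) (p.2 j.succ)) *
      gridWeight (fun i => W i.succ) p.1
  have hf : ∀ p, f p = gridWeight W (e p) := by
    intro p
    rw [gridWeight, Fin.prod_univ_succ]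
    rfl
  have hmaps : Set.BijOn e s (gridConfigs (n + 1) L left bottom top) := by
    refine ⟨?_, he.injOn, ?_⟩
    · rintro p ⟨⟨h1, h2, h3, h4⟩, h5, h6⟩
      refine ⟨rfl, h2, fun i => ?_, fun i => ?_⟩
      · rcases Fin.eq_zero_or_eq_succ i with rfl | ⟨i, rfl⟩
        · exact h5
        · exact h3 i
      · rcases Fin.eq_zero_or_eq_succ i with rfl | ⟨i, rfl⟩
        · exact h6
        · exact h4 i
    · rintro ⟨v, h⟩ ⟨h1, h2, h3, h4⟩
      refine ⟨((Fin.tail v, Fin.tail h), h 0), ⟨⟨rfl, h2, fun i => h3 i.succ, fun i => h4 i.succ⟩,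
        h3 0, h4 0⟩, ?_⟩
      refine Prod.ext ?_ (Fin.cons_self_tail h)
      change Fin.cons top (Fin.tail v) = v
      rw [← h1]
      exact Fin.cons_self_tail v
  have h1 : gridPartition (n + 1) L (fun i j => W i j) left bottom top = ∑ᶠ p ∈ s, f p :=
    (finsum_mem_eq_of_bijOn e hmaps fun p _ => hf p).symm
  have hfin : (Function.support (s.indicator f)).Finite := by
    refine ((finite_labelBox (n + 1) L (∑ j, top j)).preimage he.injOn).subset fun p hp => ?_
    rw [Function.mem_support, Set.indicator_apply_ne_zero] at hp
    exact mem_labelBox hW (hmaps.1 hp.1) (by rw [← hf]; exact hp.2)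
  have h2 : ∀ c : (Fin (n + 1) → Fin L → ℕ) × (Fin n → Fin (L + 1) → ℕ),
      ∑ᶠ y, s.indicator f (c, y) = ∑ᶠ μ, rowWeight L (W 0) (left 0) μ top *
        (gridConfigs n L (Fin.tail left) bottom μ).indicator (gridWeight fun i => W i.succ) c := by
    intro c
    rw [finsum_eq_single _ (c.1 0)]
    · by_cases hc : c ∈ gridConfigs n L (Fin.tail left) bottom (c.1 0)
      · rw [Set.indicator_of_mem hc, ← finsum_horizontal (hW 0), finsum_mem_mul, finsum_mem_def]
        refine finsum_congr fun y => ?_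
        by_cases hy : y 0 = left 0 ∧ y (Fin.last L) = 0
        · rw [Set.indicator_of_mem (show (c, y) ∈ s from ⟨hc, hy⟩)]
          symm
          apply Set.indicator_of_mem
          exact hy
        · rw [Set.indicator_of_notMem (show (c, y) ∉ s from fun h => hy h.2)]
          symm
          apply Set.indicator_of_notMem
          exact hy
      · rw [Set.indicator_of_notMem hc, mul_zero]
        exact finsum_eq_zero_of_forall_eq_zero fun y =>
          Set.indicator_of_notMem (show (c, y) ∉ s from fun h => hc h.1) _
    · intro μ hμ
      rw [Set.indicator_of_notMem (fun h => hμ h.1.symm), mul_zero]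
  rw [h1, finsum_mem_def, finsum_curry _ hfin]
  simp_rw [h2]
  rw [finsum_comm_of_finite]
  · refine finsum_congr fun μ => ?_
    rw [← mul_finsum, ← finsum_mem_def]
    rfl
  · refine ((finite_labelBox n L (∑ j, top j)).prod (finite_sum_le L (∑ j, top j))).subset
      fun p hp => ?_
    have hp1 := left_ne_zero_of_mul hp
    have hp2 := right_ne_zero_of_mul hp
    rw [Set.indicator_apply_ne_zero] at hp2
    have h3 := sum_add_eq_of_rowWeight_ne_zero (hW 0) hp1
    have h4 := mem_labelBox (fun i => hW i.succ) hp2.1 hp2.2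
    have h5 : ∑ j, p.2 j ≤ ∑ j, top j := by omega
    exact ⟨⟨fun i j => (h4.1 i j).trans h5, fun i j => (h4.2 i j).trans h5⟩, h5⟩

/-! ### Independence of the number of columns -/

theorem rowWeight_castSucc {L : ℕ} {wt : ℕ → ℕ → ℕ → ℕ → ℕ → ℂ} (hwt : ∀ c, wt c 0 0 0 0 = 1)
    {a : ℕ} {bot top : Fin (L + 1) → ℕ} (hbot : bot (Fin.last L) = 0)
    (htop : top (Fin.last L) = 0) :
    rowWeight (L + 1) wt a bot top = rowWeight L wt a (Fin.init bot) (Fin.init top) := by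
  induction L generalizing wt a with
  | zero =>
    have h1 : bot 0 = 0 := hbot
    have h2 : top 0 = 0 := htop
    simp only [rowWeight, h1, h2]
    split_ifs with h3 h4 h4
    · rw [h4, hwt, one_mul]
    · omega
    · omega
    · rw [mul_zero]
  | succ L ih =>
    rw [rowWeight, ih (bot := Fin.tail bot) (top := Fin.tail top) (fun c => hwt (c + 1)) hbot htop]
    rfl

/-- If the last column is empty on top it is empty in every contributing labelling, and all its
vertices have weight 1. -/
theorem gridPartition_castSucc {n L : ℕ} {W : Fin n → ℕ → ℕ → ℕ → ℕ → ℕ → ℂ}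
    (hW : ∀ i, Conserves (W i)) (hW0 : ∀ i c, W i c 0 0 0 0 = 1) (left : Fin n → ℕ)
    (top : Fin (L + 1) → ℕ) (htop : top (Fin.last L) = 0) :
    gridPartition n (L + 1) (fun i j => W i j) left 0 top =
      gridPartition n L (fun i j => W i j) left 0 (Fin.init top) := by
  induction n generalizing top with
  | zero =>
    rw [gridPartition_zero, gridPartition_zero]
    congr 1
    refine propext ⟨fun h => by rw [h]; rfl, fun h => funext fun j => ?_⟩
    rcases Fin.eq_castSucc_or_eq_last j with ⟨j, rfl⟩ | rfl
    · exact congrFun h j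
    · exact htop
  | succ n ih =>
    rw [gridPartition_succ hW, gridPartition_succ hW,
      ← finsum_mem_eq_finsum_of_support {μ : Fin (L + 1) → ℕ | μ (Fin.last L) = 0},
      ← finsum_mem_univ (α := Fin L → ℕ) (M := ℂ)]
    · symm
      refine finsum_mem_eq_of_bijOn (fun μ : Fin L → ℕ => (Fin.snoc μ 0 : Fin (L + 1) → ℕ))
        ⟨?_, ?_, ?_⟩ ?_
      · intro μ _
        exact Fin.snoc_last (α := fun _ => ℕ) 0 μ
      · intro μ _ μ' _ h
        exact (Fin.snoc_injective2 (α := fun _ => ℕ) h).1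
      · intro μ hμ
        refine ⟨Fin.init μ, trivial, ?_⟩
        have := Fin.snoc_init_self (α := fun _ => ℕ) μ
        rwa [show μ (Fin.last L) = 0 from hμ] at this
      · intro μ _
        have h0 : (Fin.snoc μ 0 : Fin (L + 1) → ℕ) (Fin.last L) = 0 :=
          Fin.snoc_last (α := fun _ => ℕ) 0 μ
        rw [rowWeight_castSucc (hW0 0) h0 htop, ih (fun i => hW i.succ) (fun i => hW0 i.succ) _ _ h0,
          Fin.init_snoc]
    · intro μ hμ
      have := bot_last_le_of_rowWeight_ne_zero (hW 0) (left_ne_zero_of_mul hμ)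
      simp only [Set.mem_ofPred_eq]
      omega

theorem gridPartition_eq_of_le {n L L' : ℕ} {W : Fin n → ℕ → ℕ → ℕ → ℕ → ℕ → ℂ}
    (hW : ∀ i, Conserves (W i)) (hW0 : ∀ i c, W i c 0 0 0 0 = 1) (left : Fin n → ℕ)
    (top : ℕ → ℕ) (htop : ∀ j, L ≤ j → top j = 0) (h : L ≤ L') :
    gridPartition n L' (fun i j => W i j) left 0 (fun j => top j) =
      gridPartition n L (fun i j => W i j) left 0 (fun j => top j) := by
  induction L', h using Nat.le_induction with
  | base => rfl
  | succ L' h ih =>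
    rw [gridPartition_castSucc hW hW0 left _ (htop _ (by simpa using h)), ← ih]
    rfl

/-! ### Sums over left boundary labels -/

theorem sum_gridPartition_hlCols (q : ℂ) {L : ℕ} (A B : ℕ → ℂ) {m : ℕ} (u : Fin m → ℂ)
    (t : Fin L → ℕ) :
    ∑ a : Fin m → Fin 2, (∏ i, (-(u i * A 0)) ^ (a i : ℕ)) *
      gridPartition m L (fun i j => hlCols q (u i) A B j) (fun i => (a i : ℕ)) 0 t =
        hlSum q L A B m u t := by
  induction m generalizing t with
  | zero =>
    rw [Fintype.sum_unique, gridPartition_zero (fun i : Fin 0 => hlCols q (u i) A B), hlSum]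
    simp
  | succ m ih =>
    rw [hlSum, ← (Fin.consEquiv fun _ => Fin 2).sum_comp, Fintype.sum_prod_type]
    simp only [gridPartition_succ (W := fun i => hlCols q (u i) A B)
      (fun i => conserves_hlCols _ _ _ _)]
    simp_rw [mul_finsum, ← ih, hlRow, Finset.sum_mul_sum]
    rw [finsum_sum_comm]
    · refine Finset.sum_congr rfl fun ε _ => ?_
      rw [finsum_sum_comm]
      · refine Finset.sum_congr rfl fun a _ => finsum_congr fun ρ => ?_
        rw [Fin.prod_univ_succ]
        have : Fin.tail (fun i => ((Fin.consEquiv fun _ => Fin 2) (ε, a) i : ℕ)) =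
          fun i => (a i : ℕ) := rfl
        rw [this]
        change (_ * ∏ i : Fin m, (-(u i.succ * A 0)) ^ (a i : ℕ)) * _ = _
        simp only [Fin.consEquiv_apply, Fin.cons_zero, Fin.tail]
        ring
      · intro a _
        refine (finite_sum_le L (∑ j, t j)).subset fun ρ hρ => ?_
        have := sum_add_eq_of_rowWeight_ne_zero (conserves_hlCols _ _ _ _)
          (right_ne_zero_of_mul (left_ne_zero_of_mul hρ))
        simp only [Set.mem_ofPred_eq]
        omega
    · intro ε _
      refine (finite_sum_le L (∑ j, t j)).subset fun ρ hρ => ?_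
      obtain ⟨a, -, ha⟩ := Finset.exists_ne_zero_of_sum_ne_zero hρ
      have := sum_add_eq_of_rowWeight_ne_zero (conserves_hlCols _ _ _ _)
        (right_ne_zero_of_mul (left_ne_zero_of_mul ha))
      simp only [Set.mem_ofPred_eq]
      omega

/-- With an empty bottom the constraint Σa = Σt is the conservation law of the whole grid.
Conservation in the first row turns it into the same constraint for the remaining rows, with μ in
place of t. -/
theorem finsum_gridPartition_succ {n L : ℕ} {W : Fin (n + 1) → ℕ → ℕ → ℕ → ℕ → ℕ → ℂ}
    (hW : ∀ i, Conserves (W i)) (f : Fin (n + 1) → ℕ → ℂ) (t : Fin L → ℕ) :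
    ∑ᶠ a ∈ {a : Fin (n + 1) → ℕ | ∑ i, a i = ∑ j, t j},
      (∏ i, f i (a i)) * gridPartition (n + 1) L (fun i j => W i j) a 0 t =
      ∑ᶠ μ, (∑ᶠ b, f 0 b * rowWeight L (W 0) b μ t) *
        ∑ᶠ a ∈ {a : Fin n → ℕ | ∑ i, a i = ∑ j, μ j},
          (∏ i, f i.succ (a i)) * gridPartition n L (fun i j => W i.succ j) a 0 μ := by
  let g : (Fin L → ℕ) → (Fin n → ℕ) → ℂ := fun μ =>
    {a : Fin n → ℕ | ∑ i, a i = ∑ j, μ j}.indicator fun a =>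
      (∏ i, f i.succ (a i)) * gridPartition n L (fun i j => W i.succ j) a 0 μ
  have hg : ∀ μ a, g μ a ≠ 0 → ∑ i, a i = ∑ j, μ j := fun μ a h =>
    (Set.indicator_apply_ne_zero.1 h).1
  have key : ∀ p : ℕ × (Fin n → ℕ), {a : Fin (n + 1) → ℕ | ∑ i, a i = ∑ j, t j}.indicator
      (fun a => (∏ i, f i (a i)) * gridPartition (n + 1) L (fun i j => W i j) a 0 t)
      (Fin.consEquiv (fun _ => ℕ) p) =
      ∑ᶠ μ, f 0 p.1 * rowWeight L (W 0) p.1 μ t * g μ p.2 := by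
    rintro ⟨b, a⟩
    have hsum : ∑ i, (Fin.consEquiv fun _ => ℕ) (b, a) i = b + ∑ i, a i := Fin.sum_cons b a
    by_cases h : b + ∑ i, a i = ∑ j, t j
    · rw [Set.indicator_of_mem (by rw [Set.mem_ofPred_eq, hsum, h]), gridPartition_succ hW,
        mul_finsum]
      refine finsum_congr fun μ => ?_
      by_cases hz : rowWeight L (W 0) b μ t = 0
      · change _ * (rowWeight L (W 0) b μ t * _) = _
        rw [hz]
        ring
      · have h1 := sum_add_eq_of_rowWeight_ne_zero (hW 0) hz
        have h2 : g μ a = (∏ i, f i.succ (a i)) *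
            gridPartition n L (fun i j => W i.succ j) a 0 μ := by
          apply Set.indicator_of_mem
          change ∑ i, a i = ∑ j, μ j
          omega
        rw [h2, Fin.prod_univ_succ]
        change (f 0 b * ∏ i : Fin n, f i.succ (a i)) * (rowWeight L (W 0) b μ t *
          gridPartition n L (fun i j => W i.succ j) a 0 μ) = _
        ring
    · rw [Set.indicator_of_notMem (by rw [Set.mem_ofPred_eq, hsum]; exact h)]
      symm
      refine finsum_eq_zero_of_forall_eq_zero fun μ => by_contra fun hne => h ?_
      have h1 := sum_add_eq_of_rowWeight_ne_zero (hW 0)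
        (right_ne_zero_of_mul (left_ne_zero_of_mul hne))
      have h2 := hg _ _ (right_ne_zero_of_mul hne)
      dsimp only at h1 h2
      omega
  rw [finsum_mem_def, ← finsum_comp_equiv (Fin.consEquiv fun _ => ℕ)]
  simp_rw [key]
  rw [finsum_comm_of_finite]
  · refine finsum_congr fun μ => ?_
    rw [finsum_mem_def, finsum_curry]
    · change ∑ᶠ b, ∑ᶠ a, f 0 b * rowWeight L (W 0) b μ t * g μ a = _ * ∑ᶠ a, g μ a
      simp_rw [← mul_finsum]
      rw [finsum_mul]
    · refine ((Set.finite_Iic (∑ j, t j)).prod (finite_sum_le n (∑ j, μ j))).subset fun p hp => ?_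
      have h1 := sum_add_eq_of_rowWeight_ne_zero (hW 0)
        (right_ne_zero_of_mul (left_ne_zero_of_mul hp))
      have h2 := hg _ _ (right_ne_zero_of_mul hp)
      exact ⟨by simp only [Set.mem_Iic]; omega, h2.le⟩
  · refine (((Set.finite_Iic (∑ j, t j)).prod (finite_sum_le n (∑ j, t j))).prod
      (finite_sum_le L (∑ j, t j))).subset fun p hp => ?_
    have h1 := sum_add_eq_of_rowWeight_ne_zero (hW 0)
      (right_ne_zero_of_mul (left_ne_zero_of_mul hp))
    have h2 := hg _ _ (right_ne_zero_of_mul hp)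
    refine ⟨⟨?_, ?_⟩, ?_⟩ <;> simp only [Set.mem_ofPred_eq, Set.mem_Iic] <;> omega

theorem finsum_gridPartition_qHahnCols (q : ℂ) {L : ℕ} (A B : ℕ → ℂ) {n : ℕ} (κ : Fin n → ℂ)
    (t : Fin L → ℕ) :
    ∑ᶠ a ∈ {a : Fin n → ℕ | ∑ i, a i = ∑ j, t j},
      (∏ i, leftWeight q (κ i) (fun k => A (k + i)) B (a i)) *
        gridPartition n L (fun i j => qHahnCols q (κ i) (fun k => A (k + i)) B j) a 0 t =
      qHahnSum q L B n κ A t := by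
  induction n generalizing A t with
  | zero =>
    rw [finsum_mem_def, finsum_unique, qHahnSum]
    simp only [gridPartition_zero (fun i : Fin 0 => qHahnCols q (κ i) (fun k => A (k + i)) B),
      Finset.univ_eq_empty, Finset.prod_empty, one_mul, Finset.sum_empty]
    split_ifs with h
    · exact Set.indicator_of_mem (by simp [h]) _
    · rw [Set.indicator_apply_eq_zero]
      exact fun _ => rfl
  | succ n ih =>
    rw [finsum_gridPartition_succ (W := fun i => qHahnCols q (κ i) (fun k => A (k + i)) B)
      (fun i => conserves_qHahnCols _ _ _ _) (fun i => leftWeight q (κ i) (fun k => A (k + i)) B),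
      qHahnSum]
    refine finsum_congr fun μ => ?_
    rw [← ih]
    rfl

/-! ### Partitions as label functions -/

theorem rowLen_pos_iff {lam : YoungDiagram} {i : ℕ} : 0 < lam.rowLen i ↔ i < len lam := by
  rw [len, ← YoungDiagram.mem_iff_lt_rowLen, YoungDiagram.mem_iff_lt_colLen]

theorem rowLen_eq_zero {lam : YoungDiagram} {i : ℕ} (h : len lam ≤ i) : lam.rowLen i = 0 := by
  by_contra h'
  have := rowLen_pos_iff.1 (Nat.pos_of_ne_zero h')
  omega

theorem colLabel_eq_zero {lam : YoungDiagram} {i : ℕ} (h : len lam ≤ i) : colLabel lam i = 0 := by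
  rw [colLabel, rowLen_eq_zero h, Nat.zero_sub]

theorem colLabel_add (lam : YoungDiagram) (i : ℕ) :
    colLabel lam i + lam.rowLen (i + 1) = lam.rowLen i :=
  Nat.sub_add_cancel (lam.rowLen_anti i (i + 1) (Nat.le_succ i))

theorem len_bot : len ⊥ = 0 := by
  by_contra h
  exact YoungDiagram.notMem_bot _ (YoungDiagram.mem_iff_lt_colLen.2 (Nat.pos_of_ne_zero h))

theorem transpose_bot : (⊥ : YoungDiagram).transpose = ⊥ := by
  simp [YoungDiagram.ext_iff, YoungDiagram.transpose]

theorem ext_of_rowLen {lam mu : YoungDiagram} (h : ∀ i, lam.rowLen i = mu.rowLen i) :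
    lam = mu := by
  ext ⟨i, j⟩
  rw [YoungDiagram.mem_cells, YoungDiagram.mem_cells, YoungDiagram.mem_iff_lt_rowLen,
    YoungDiagram.mem_iff_lt_rowLen, h]

/-- The labels of the top edges of the first `L` columns. -/
def topLabels (L : ℕ) (lam : YoungDiagram) (j : Fin L) : ℕ := colLabel lam j

theorem sum_topLabels {L : ℕ} {lam : YoungDiagram} (h : len lam ≤ L) :
    ∑ j, topLabels L lam j = lam.rowLen 0 := by
  have key : ∀ L, ∑ j ∈ Finset.range L, colLabel lam j + lam.rowLen L = lam.rowLen 0 := by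
    intro L
    induction L with
    | zero => simp
    | succ L ih =>
      rw [Finset.sum_range_succ, ← ih, ← colLabel_add lam L]
      ring
  have := key L
  rw [rowLen_eq_zero h, add_zero, Finset.sum_range] at this
  exact this

theorem injOn_topLabels (L : ℕ) : Set.InjOn (topLabels L) {lam | len lam ≤ L} := by
  intro lam hlam mu hmu h
  refine ext_of_rowLen fun i => ?_
  rcases le_total L i with hi | hi
  · rw [rowLen_eq_zero (le_trans hlam hi), rowLen_eq_zero (le_trans hmu hi)]
  · induction hi using Nat.decreasingInduction with
    | self => rw [rowLen_eq_zero hlam, rowLen_eq_zero hmu]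
    | of_succ k hk ih =>
      rw [← colLabel_add lam, ← colLabel_add mu, ih]
      congr 1
      exact congrFun h ⟨k, hk⟩

theorem surjOn_topLabels (L : ℕ) : Set.SurjOn (topLabels L) {lam | len lam ≤ L} Set.univ := by
  intro t _
  -- The partition is recovered from its differences by the tail sums r_k = Σ_{j ≥ k} t_j.
  let r : ℕ → ℕ := fun k => ∑ j : Fin L, if k ≤ j then t j else 0
  have hr : ∀ k k', k ≤ k' → r k' ≤ r k := fun k k' h => Finset.sum_le_sum fun j _ => by
    split_ifs <;> omega
  have hr0 : ∀ k, L ≤ k → r k = 0 := fun k h => Finset.sum_eq_zero fun j _ =>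
    if_neg (by have := j.2; omega)
  let lam : YoungDiagram :=
    { cells := (Finset.range L ×ˢ Finset.range (r 0)).filter fun c => c.2 < r c.1
      isLowerSet := by
        rintro ⟨i, j⟩ ⟨i', j'⟩ ⟨hi, hj⟩ h
        simp only [Finset.coe_filter, Finset.mem_product, Finset.mem_range,
          Set.mem_ofPred_eq] at h ⊢
        have := hr i' i hi
        dsimp only at hi hj
        omega }
  have hlam : ∀ i, lam.rowLen i = r i := by
    intro i
    refine eq_of_forall_lt_iff fun j => ?_
    rw [← YoungDiagram.mem_iff_lt_rowLen, ← YoungDiagram.mem_cells]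
    simp only [lam, Finset.mem_filter, Finset.mem_product, Finset.mem_range]
    have h1 := hr 0 i (Nat.zero_le _)
    have h2 := hr0 i
    constructor
    · exact fun h => h.2
    · intro h
      refine ⟨⟨?_, by omega⟩, h⟩
      by_contra h'
      have := h2 (by omega)
      omega
  refine ⟨lam, ?_, ?_⟩
  · by_contra h
    have := rowLen_pos_iff.2 (not_le.1 h)
    rw [hlam, hr0 L le_rfl] at this
    omega
  · funext k
    have h1 : colLabel lam k + r (k + 1) = r k := by
      rw [← hlam, ← hlam, colLabel_add]
    have h2 : r k = t k + r (k + 1) := by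
      have : ∀ j : Fin L, (if (k : ℕ) ≤ j then t j else 0) =
          (if j = k then t j else 0) + if (k : ℕ) + 1 ≤ j then t j else 0 := by
        intro j
        by_cases h : j = k
        · subst h
          simp
        · have : (j : ℕ) ≠ k := fun h' => h (Fin.ext h')
          rw [if_neg h, zero_add]
          exact if_congr (by omega) rfl rfl
      simp only [r]
      rw [Finset.sum_congr rfl fun j _ => this j, Finset.sum_add_distrib]
      simp
    simp only [topLabels]
    omega

/-- The tail sums of differences appearing as exponents telescope back to the parts, which gives the
closed product form. -/
theorem fullNorm_differences (q : ℂ) (L : ℕ) (A B : ℕ → ℂ) (r : ℕ → ℕ)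
    (hr : ∀ k, r (k + 1) ≤ r k) (hL : r L = 0) :
    fullNorm q L A B (fun j => r j - r (j + 1)) =
      (∏ k ∈ Finset.range L, ((A k * B k) ^ r k)⁻¹) *
        ∏ k ∈ Finset.range L, labelNorm q (A (k + 1) * B (k + 1)) (r k - r (k + 1)) := by
  have hsum : ∀ (L : ℕ) (r : ℕ → ℕ) (_ : ∀ k, r (k + 1) ≤ r k) (_ : r L = 0),
      ∑ j : Fin L, (r j - r (j + 1)) = r 0 := by
    intro L
    induction L with
    | zero => exact fun r _ h => h.symm
    | succ L ih =>
      intro r hr hL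
      rw [Fin.sum_univ_succ]
      have h1 := ih (fun k => r (k + 1)) (fun k => hr _) hL
      have h2 := hr 0
      simp only [Fin.val_succ, Fin.val_zero] at h1 ⊢
      rw [h1]
      omega
  induction L generalizing A B r with
  | zero => simp [fullNorm, partitionNorm]
  | succ L ih =>
    have ih := ih (shift A) (shift B) (fun k => r (k + 1)) (fun k => hr _) hL
    rw [fullNorm, partitionNorm, hsum _ r hr hL, Finset.prod_range_succ', Finset.prod_range_succ']
    have h1 : labelNorm q (A 1 * B 1) (r (0 : Fin (L + 1)) - r ((0 : Fin (L + 1)) + 1)) *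
        ((A 1 * B 1) ^ (∑ j, Fin.tail (fun j : Fin (L + 1) => r j - r (j + 1)) j))⁻¹ *
        partitionNorm q L (shift A) (shift B) (Fin.tail fun j : Fin (L + 1) => r j - r (j + 1)) =
        labelNorm q (A 1 * B 1) (r 0 - r 1) *
          fullNorm q L (shift A) (shift B) (fun j => r (j + 1) - r (j + 1 + 1)) := by
      rw [fullNorm, mul_assoc]
      rfl
    rw [h1, ih]
    simp only [shift]
    ring

/-! ### Spin functions as iterated one-row operators -/

theorem mixedShift_sq (k : ℕ) (B A : ℕ → ℂ) (i : ℕ) :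
    mixedShift k B A i ^ 2 = A (i + k) * B (i + k) * A i / B i := by
  rw [mixedShift, Complex.sqrt, ← Complex.cpow_nat_mul]
  simp

theorem sqrt_sq (z : ℂ) : Complex.sqrt z ^ 2 = z := by
  rw [Complex.sqrt, ← Complex.cpow_nat_mul]
  simp

theorem colLabel_bot (j : ℕ) : colLabel ⊥ j = 0 :=
  colLabel_eq_zero (by rw [len_bot]; exact Nat.zero_le _)

theorem cNorm_bot (q : ℂ) (S : ℕ → ℂ) : cNorm q S ⊥ = 1 := by simp [cNorm, len_bot]

theorem negPow_bot (S : ℕ → ℂ) : negPow S ⊥ = 1 := by simp [negPow, len_bot]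

theorem Zw_eq {q : ℂ} {m : ℕ} {u : Fin m → ℂ} {Xi S : ℕ → ℂ}
    (hw : ∀ (i : Fin m) (j : ℕ), 1 ≤ j → S j * (u i * Xi j) ≠ 1) (hXi : ∀ i, Xi i ≠ 0)
    {lam : YoungDiagram} {L : ℕ} (hL : len lam ≤ L) (a : Fin m → ℕ) :
    Zw q u Xi S lam ⊥ a = gridPartition m L
      (fun i j => hlCols q (u i) (fun k => Xi k * S k) (fun k => S k / Xi k) j) a 0
      (topLabels L lam) := by
  have hwt : ∀ (i : Fin m) (j : ℕ), wWeight q (u i * Xi (j + 1)) (S (j + 1)) =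
      hlCols q (u i) (fun k => Xi k * S k) (fun k => S k / Xi k) j := by
    intro i j
    have := hXi (j + 1)
    rw [wWeight_eq, hlCols]
    congr 1
    · ring
    · field_simp
  have hu : ∀ (i : Fin m) (c : ℕ),
      hlCols q (u i) (fun k => Xi k * S k) (fun k => S k / Xi k) c 0 0 0 0 = 1 := by
    intro i c
    refine hlWeight_zero _ _ _ fun h => hw i (c + 1) (by omega) ?_
    rw [← h]
    ring
  have hbot : (fun j : Fin (numCols lam ⊥) => colLabel ⊥ j) = 0 := funext fun j => colLabel_bot j
  have h := fun L hL => gridPartition_eq_of_le (L := len lam) (L' := L)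
    (W := fun i => hlCols q (u i) (fun k => Xi k * S k) (fun k => S k / Xi k))
    (fun i => conserves_hlCols _ _ _ _) hu a (colLabel lam) (fun j hj => colLabel_eq_zero hj) hL
  rw [Zw, hbot]
  simp only [hwt]
  exact (h _ (by rw [numCols]; omega)).trans (h L hL).symm

/-- With zero-based row i, the sequence A is shifted by i and B is not. The common L serves all
partitions at once, whereas the definition lets the grid grow with λ. -/
theorem ZW_eq (q : ℂ) {n : ℕ} (kap : Fin n → ℂ) (Xi S : ℕ → ℂ) {lam : YoungDiagram} {L : ℕ}
    (hL : len lam ≤ L) (a : Fin n → ℕ) :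
    ZW q kap Xi S lam ⊥ a = gridPartition n L
      (fun i j => qHahnCols q (kap i) (fun k => Xi (k + i) * S (k + i)) (fun k => S k / Xi k) j) a 0
      (topLabels L lam) := by
  have hwt : ∀ (i : Fin n) (j : ℕ), WWeight q
      (Complex.sqrt (Xi ((i + 1 : ℕ) + (j + 1)) * S ((i + 1 : ℕ) + (j + 1)) / kap i))
      (mixedShift (i + 1) Xi S (j + 1)) =
      qHahnCols q (kap i) (fun k => Xi (k + i) * S (k + i)) (fun k => S k / Xi k) j := by
    intro i j
    rw [WWeight_eq, sqrt_sq, mixedShift_sq, qHahnCols,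
      show (i : ℕ) + 1 + (j + 1) = j + 2 + i by omega,
      show j + 1 + ((i : ℕ) + 1) = j + 2 + i by omega]
    congr 1
    ring
  have hbot : (fun j : Fin (numCols lam ⊥) => colLabel ⊥ j) = 0 := funext fun j => colLabel_bot j
  have h := fun L hL => gridPartition_eq_of_le (L := len lam) (L' := L)
    (W := fun i => qHahnCols q (kap i) (fun k => Xi (k + i) * S (k + i)) (fun k => S k / Xi k))
    (fun i => conserves_qHahnCols _ _ _ _) (fun i c => qHahnWeight_zero _ _ _) a (colLabel lam)
    (fun j hj => colLabel_eq_zero hj) hL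
  rw [ZW, hbot]
  simp only [hwt]
  exact (h _ (by rw [numCols]; omega)).trans (h L hL).symm

theorem stableHLStoch_eq {q : ℂ} {m : ℕ} {u : Fin m → ℂ} {Xi S : ℕ → ℂ}
    (hw : ∀ (i : Fin m) (j : ℕ), 1 ≤ j → S j * (u i * Xi j) ≠ 1) (hXi : ∀ i, Xi i ≠ 0)
    {lam : YoungDiagram} {L : ℕ} (hL : len lam ≤ L) :
    stableHLStoch q u Xi S lam.transpose ⊥ =
      hlSum q L (fun k => Xi k * S k) (fun k => S k / Xi k) m u (topLabels L lam) := by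
  rw [stableHLStoch, YoungDiagram.transpose_transpose, transpose_bot, ← sum_gridPartition_hlCols]
  refine Finset.sum_congr rfl fun a _ => ?_
  rw [Zw_eq hw hXi hL]
  congr 1
  exact Finset.prod_congr rfl fun i _ => by ring

theorem spinWhittakerStoch_eq (q : ℂ) {n : ℕ} {kap : Fin n → ℂ} {Xi S : ℕ → ℂ}
    {lam : YoungDiagram} {L : ℕ} (hL : len lam ≤ L) :
    spinWhittakerStoch q kap Xi S lam ⊥ =
      qHahnSum q L (fun k => S k / Xi k) n kap (fun k => Xi k * S k) (topLabels L lam) := by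
  rw [spinWhittakerStoch, ← finsum_gridPartition_qHahnCols, sum_topLabels hL,
    rowLen_eq_zero (lam := ⊥) (by rw [len_bot])]
  refine finsum_mem_congr rfl fun a _ => ?_
  rw [ZW_eq q kap Xi S hL]
  congr 1
  refine Finset.prod_congr rfl fun i _ => ?_
  rw [leftWeight, mul_div_assoc, add_comm 1 (i : ℕ)]
  congr 3
  ring

theorem cNorm_ne_zero {q : ℂ} {S : ℕ → ℂ} (hq : ∀ r : ℕ, 1 ≤ r → q ^ r ≠ 1)
    (hc : ∀ j : ℕ, 1 ≤ j → ∀ r : ℕ, S j ^ 2 * q ^ r ≠ 1) (lam : YoungDiagram) :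
    cNorm q S lam ≠ 0 :=
  Finset.prod_ne_zero_iff.2 fun i _ =>
    div_ne_zero (qPoch_ne_zero (hc (i + 1) (by omega)) _) (qPoch_self_ne_zero hq _)

/-- The two functions together contribute (-S)^{-λ} twice, so the signs cancel and powers of s² = AB
remain. Of their two factors 1/c one is cancelled by the dual normalization. -/
theorem inv_negPow_sq_mul_inv_cNorm (q : ℂ) {Xi S : ℕ → ℂ} (hXi : ∀ i, Xi i ≠ 0)
    {lam : YoungDiagram} {L : ℕ} (hL : len lam ≤ L) :
    (negPow S lam)⁻¹ * ((negPow S lam)⁻¹ * (cNorm q S lam)⁻¹) =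
      fullNorm q L (fun k => Xi k * S k) (fun k => S k / Xi k) (topLabels L lam) := by
  have hAB : ∀ k, Xi k * S k * (S k / Xi k) = S k ^ 2 := fun k => by
    have := hXi k
    field_simp
  have h := fullNorm_differences q L (fun k => Xi k * S k) (fun k => S k / Xi k) lam.rowLen
    (fun k => lam.rowLen_anti k (k + 1) (Nat.le_succ k)) (rowLen_eq_zero hL)
  have hsub : Finset.range (len lam) ⊆ Finset.range L := Finset.range_subset_range.2 hL
  have h1 : negPow S lam = ∏ k ∈ Finset.range L, (-S k) ^ lam.rowLen k :=
    Finset.prod_subset hsub fun k _ hk => by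
      rw [rowLen_eq_zero (not_lt.1 fun h => hk (Finset.mem_range.2 h)), pow_zero]
  have h2 : cNorm q S lam = ∏ k ∈ Finset.range L,
      qPoch q (S (k + 1) ^ 2) (colLabel lam k) / qPoch q q (colLabel lam k) :=
    Finset.prod_subset hsub fun k _ hk => by
      rw [colLabel_eq_zero (not_lt.1 fun h => hk (Finset.mem_range.2 h)), qPoch_zero, qPoch_zero,
        div_one]
  rw [show topLabels L lam = fun j : Fin L => lam.rowLen j - lam.rowLen (j + 1) from rfl, h, h1, h2,
    ← Finset.prod_inv_distrib, ← Finset.prod_inv_distrib, ← mul_assoc, ← Finset.prod_mul_distrib]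
  congr 1
  · refine Finset.prod_congr rfl fun k _ => ?_
    rw [hAB, ← mul_inv, ← mul_pow]
    ring
  · refine Finset.prod_congr rfl fun k _ => ?_
    rw [hAB, inv_div]
    rfl

theorem dualCauchy_term {q : ℂ} {m n : ℕ} {u : Fin m → ℂ} {kap : Fin n → ℂ} {Xi S : ℕ → ℂ}
    (hq : ∀ r : ℕ, 1 ≤ r → q ^ r ≠ 1) (hXi : ∀ i, Xi i ≠ 0)
    (hc : ∀ j : ℕ, 1 ≤ j → ∀ r : ℕ, S j ^ 2 * q ^ r ≠ 1)
    (hw : ∀ (i : Fin m) (j : ℕ), 1 ≤ j → S j * (u i * Xi j) ≠ 1)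
    {lam : YoungDiagram} {L : ℕ} (hL : len lam ≤ L) :
    stableHLDual q u Xi S lam.transpose * spinWhittaker q kap Xi S lam =
      fullNorm q L (fun k => Xi k * S k) (fun k => S k / Xi k) (topLabels L lam) *
        hlSum q L (fun k => Xi k * S k) (fun k => S k / Xi k) m u (topLabels L lam) *
        qHahnSum q L (fun k => S k / Xi k) n kap (fun k => Xi k * S k) (topLabels L lam) := by
  rw [stableHLDual, stableHLDualSkew, stableHLSkew, spinWhittaker, spinWhittakerSkew,
    stableHLStoch_eq hw hXi hL, spinWhittakerStoch_eq q hL, transpose_bot,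
    YoungDiagram.transpose_transpose, cNorm_bot, cNorm_bot, negPow_bot, negPow_bot,
    ← inv_negPow_sq_mul_inv_cNorm q hXi hL]
  have := cNorm_ne_zero hq hc lam
  field_simp

theorem len_le_of_spinWhittaker_ne_zero {q : ℂ} {n : ℕ} {kap : Fin n → ℂ} {Xi S : ℕ → ℂ}
    {lam : YoungDiagram} (h : spinWhittaker q kap Xi S lam ≠ 0) : len lam ≤ n := by
  rw [spinWhittaker, spinWhittakerSkew, spinWhittakerStoch_eq q le_rfl] at h
  by_contra hn
  have h0 := eq_zero_of_qHahnSum_ne_zero (right_ne_zero_of_mul h)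
    ⟨len lam - 1, by omega⟩ (by simp only; omega)
  have h1 := colLabel_add lam (len lam - 1)
  rw [rowLen_eq_zero (by omega), show colLabel lam (len lam - 1) = 0 from h0] at h1
  have h2 : 0 < lam.rowLen (len lam - 1) := rowLen_pos_iff.2 (by omega)
  omega

end SpinQWhittaker

end

/-! ### The dual Cauchy identity -/

theorem mainTheorem10 (q : ℂ) (Xi S : ℕ → ℂ) (n m : ℕ) (kap : Fin n → ℂ) (u : Fin m → ℂ)
    (hq : ∀ r : ℕ, 1 ≤ r → q ^ r ≠ 1)
    (hXi : ∀ i, Xi i ≠ 0) (hS : ∀ i, S i ≠ 0) (hkap : ∀ i, kap i ≠ 0)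
    (hc : ∀ j : ℕ, 1 ≤ j → ∀ r : ℕ, S j ^ 2 * q ^ r ≠ 1)
    (hW : ∀ i j : ℕ, 1 ≤ i → i ≤ n → 1 ≤ j → ∀ r : ℕ,
      S (i + j) * Xi (i + j) * S j / Xi j * q ^ r ≠ 1)
    (hw : ∀ (i : Fin m) (j : ℕ), 1 ≤ j → S j * (u i * Xi j) ≠ 1) :
    {lam : YoungDiagram | SpinQWhittaker.stableHLDual q u Xi S lam.transpose *
        SpinQWhittaker.spinWhittaker q kap Xi S lam ≠ 0}.Finite ∧
      ∑ᶠ lam : YoungDiagram, SpinQWhittaker.stableHLDual q u Xi S lam.transpose *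
          SpinQWhittaker.spinWhittaker q kap Xi S lam =
        ∏ i : Fin n, ∏ j : Fin m,
          (1 - u j * kap i) / (1 - u j * Xi ((i : ℕ) + 1) * S ((i : ℕ) + 1)) := by
  have hterm := fun lam hL => SpinQWhittaker.dualCauchy_term (kap := kap) hq hXi hc hw (lam := lam)
    (L := n + 1) hL
  have hlen : ∀ lam, SpinQWhittaker.stableHLDual q u Xi S lam.transpose *
      SpinQWhittaker.spinWhittaker q kap Xi S lam ≠ 0 → SpinQWhittaker.len lam ≤ n + 1 :=
    fun lam h => (SpinQWhittaker.len_le_of_spinWhittaker_ne_zero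
      (right_ne_zero_of_mul h)).trans (Nat.le_succ n)
  have hinj := SpinQWhittaker.injOn_topLabels (n + 1)
  constructor
  -- A nonzero term has at most n + 1 labels, and these sum to λ_1 ≤ m.
  · refine Set.Finite.of_injOn (f := SpinQWhittaker.topLabels (n + 1))
      (t := {t | ∑ j, t j ≤ m}) ?_ (hinj.mono hlen) (SpinQWhittaker.finite_sum_le (n + 1) m)
    intro lam h
    rw [Set.mem_ofPred_eq, hterm lam (hlen lam h)] at h
    exact SpinQWhittaker.sum_le_of_hlSum_ne_zero (right_ne_zero_of_mul (left_ne_zero_of_mul h))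
  · have hsum := finsum_mem_eq_of_bijOn (SpinQWhittaker.topLabels (n + 1))
      (f := fun lam => SpinQWhittaker.stableHLDual q u Xi S lam.transpose *
        SpinQWhittaker.spinWhittaker q kap Xi S lam)
      (g := fun t =>
        SpinQWhittaker.fullNorm q (n + 1) (fun k => Xi k * S k) (fun k => S k / Xi k) t *
        SpinQWhittaker.hlSum q (n + 1) (fun k => Xi k * S k) (fun k => S k / Xi k) m u t *
        SpinQWhittaker.qHahnSum q (n + 1) (fun k => S k / Xi k) n kap (fun k => Xi k * S k) t)
      (⟨fun _ _ => Set.mem_univ _, hinj, SpinQWhittaker.surjOn_topLabels (n + 1)⟩ :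
        Set.BijOn (SpinQWhittaker.topLabels (n + 1)) {lam | SpinQWhittaker.len lam ≤ n + 1}
          Set.univ) hterm
    rw [← SpinQWhittaker.finsum_mem_eq_finsum_of_support
      {lam | SpinQWhittaker.len lam ≤ n + 1} _ hlen, hsum,
      finsum_mem_univ, SpinQWhittaker.dualCauchy_rows hq le_rfl hkap
        (fun j => mul_ne_zero (hXi j) (hS j)) (fun j => div_ne_zero (hS j) (hXi j))]
    · simp only [mul_assoc]
    · intro i j r hi
      have hX := hXi (j + 1)
      -- Unshifted, A_jB_j = s_j² is a parameter of the w-vertices and of c; for i ≥ 1, A_{i+j}B_j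
      -- is the parameter s² of the W-vertices in row i.
      rcases Nat.eq_zero_or_pos i with rfl | hi'
      · have := hc (j + 1) (by omega) r
        rw [zero_add]
        convert this using 2
        field_simp
      · have := hW i (j + 1) hi' hi (by omega) r
        rw [← add_assoc] at this
        convert this using 2
        ring
    · intro i j h
      refine hw i (j + 1) (by omega) ?_
      rw [← h]
      ring
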